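/- Let $Q$ be a smooth (Hausdorff, second countable, finite-dimensional) manifold, $T^1_kQ=TQ\oplus_Q\cdots\oplus_Q TQ$ ($k$ copies) its $k$-tangent bundle, with points $(q;v_1,\dots,v_k)$ and projection $\pi:T^1_kQ\to Q$. For $w\in T_qQ$ and $x=(q;v_1,\dots,v_k)$ let $w^{\wedge\alpha}_x=\frac{d}{dt}\big|_{t=0}(q;v_1,\dots,v_\alpha+tw,\dots,v_k)$, let $J^\alpha_x(u)=(T\pi(u))^{\wedge\alpha}_x$, and let $\Delta_x=\sum_\alpha (v_\alpha)^{\wedge\alpha}_x$. A $k$-vector field on $T^1_kQ$ is a $k$-tuple $\mathbf X=(X_1,\dots,X_k)$ of smooth vector fields; it is vertical if $T\pi(X_\alpha)=0$ for all $\alpha$, and it is a SOPDE if $T\pi(X_\alpha(q;v_1,\dots,v_k))=v_\alpha$ for all $\alpha$ at every point. Let $\mathcal L\in C^\infty(T^1_kQ)$ be any Lagrangian (in particular, any almost-regular one). Put $\omega^\alpha_{\mathcal L}=-d(d\mathcal L\circ J^\alpha)$, $\mathcal E_{\mathcal L}=\Delta(\mathcal L)-\mathcal L$ and $\mathbf\Omega_{\mathcal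 L}(\mathbf X)=\sum_\alpha i(X_\alpha)\omega^\alpha_{\mathcal L}$, also for $k$-tuples of tangent vectors at one point. The Lagrangian equation is $\mathbf\Omega_{\mathcal L}(\mathbf X)=d\mathcal E_{\mathcal L}$. Let $P_1$ be the set of points $x$ with $(d\mathcal E_{\mathcal L})_x\in\operatorname{Im}(\mathbf\Omega_{\mathcal L})_x$. Let $\mathfrak M$ be the set of smooth vector fields $Z$ on $T^1_kQ$ with $\mathbf\Omega_{\mathcal L}(\mathbf V)(Z)=0$ for every vertical $k$-vector field $\mathbf V$, and let $\mathfrak M_x\subseteq T_x(T^1_kQ)$ be the space of $z$ with $\mathbf\Omega_{\mathcal L}(\mathbf v)(z)=0$ for every $k$-tuple $\mathbf v$ of vertical tangent vectors at $x$. Let $\mathbf X$ be a $k$-vector field that solves the Lagrangian equation at every point of $P_1$, let $\mathbf Y$ be a $k$-vector field such that $\mathbf X+\mathbf Y$ is a SOPDE, and let $$S_1=\Big\{x\in P_1:\ \exists\,\mathbf y\in\ker(\mathbf\Omega_{\mathcal L})_x,\ \sum_{\alpha}J^\alpha(X_\alpha(x)+y_\alpha)=\Delta_x\Big\}.$$ Then: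 1. $S_1$ is the largest subset $S\subseteq P_1$ such that for every $x\in S$ there is a SOPDE that solves the Lagrangian equation at $x$. 2. $S_1=\{x\in P_1:\ \mathbf\Omega_{\mathcal L}(\mathbf Y)_x(z)=0\text{ for all }z\in\mathfrak M_x\}$. 3. $S_1\subseteq\{x\in P_1:\ (i(Z)\mathbf\Omega_{\mathcal L}(\mathbf Y))(x)=0\text{ for all }Z\in\mathfrak M\}$. If every point of $P_1$ has a neighbourhood in $T^1_kQ$ on which $\dim\mathfrak M_x$ is constant, then $$S_1=\{x\in P_1:\ (i(Z)\mathbf\Omega_{\mathcal L}(\mathbf Y))(x)=0\text{ for all }Z\in\mathfrak M\};$$ if moreover $P_1$ is closed, then $S_1$ is the largest subset $S$ of $P_1$ for which there is a single SOPDE that solves the Lagrangian equation at all points of $S$. 4. $S_1$ and the sets on the right-hand sides in 2 and 3 do not depend on the choice of $(\mathbf X,\mathbf Y)$. -/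

import Mathlib

open Bundle Set Topology
open scoped Manifold ContDiff Bundle

noncomputable section

namespace KSymplectic

/-! ### The `k`-tangent bundle `T¹ₖQ = TQ ⊕ ⋯ ⊕ TQ` -/

section KTangentBundle

variable (E : Type*) [NormedAddCommGroup E] [NormedSpace ℝ E]
  {Q : Type*} [TopologicalSpace Q] [ChartedSpace E Q]

/-- The fibre of the `k`-tangent bundle at `q`: the `k`-tuples `(v₁, …, vₖ)` of tangent vectors
at `q`. -/
def KTangentSpace (k : ℕ) (q : Q) : Type _ := Fin k → TangentSpace 𝓘(ℝ, E) q

instance (k : ℕ) (q : Q) : TopologicalSpace (KTangentSpace E k q) :=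
  inferInstanceAs (TopologicalSpace (Fin k → TangentSpace 𝓘(ℝ, E) q))

instance (k : ℕ) (q : Q) : AddCommGroup (KTangentSpace E k q) :=
  inferInstanceAs (AddCommGroup (Fin k → TangentSpace 𝓘(ℝ, E) q))

instance (k : ℕ) (q : Q) : Module ℝ (KTangentSpace E k q) :=
  inferInstanceAs (Module ℝ (Fin k → TangentSpace 𝓘(ℝ, E) q))

variable {E} in
/-- `A ↦ A ⊕ ⋯ ⊕ A` depends linearly and continuously on `A`. -/
theorem exists_clm_piMap (k : ℕ) : ∃ D : (E →L[ℝ] E) →L[ℝ] ((Fin k → E) →L[ℝ] (Fin k → E)),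
    ∀ A : E →L[ℝ] E, D A = ContinuousLinearMap.piMap fun _ : Fin k => A := by
  refine ⟨∑ a : Fin k,
    (ContinuousLinearMap.compL ℝ (Fin k → E) E (Fin k → E)
        (ContinuousLinearMap.single ℝ (fun _ : Fin k => E) a)).comp
      ((ContinuousLinearMap.compL ℝ (Fin k → E) E E).flip
        (ContinuousLinearMap.proj (φ := fun _ : Fin k => E) a)), fun A => ?_⟩
  ext v b
  simp [Finset.sum_apply, Pi.single_apply]

variable (Q)

/-- The total space of the `k`-tangent bundle; its points are `(q; v₁, …, vₖ)`. -/
abbrev KTangentBundle (k : ℕ) : Type _ :=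
  TotalSpace (Fin k → E) (KTangentSpace E k : Q → Type _)

/-- The coordinate changes of `T¹ₖQ`: those of `TQ` acting on each of the `k` components. -/
def kTangentCore (k : ℕ) [IsManifold 𝓘(ℝ, E) 1 Q] :
    VectorBundleCore ℝ Q (Fin k → E) (atlas E Q) where
  baseSet := (tangentBundleCore 𝓘(ℝ, E) Q).baseSet
  isOpen_baseSet := (tangentBundleCore 𝓘(ℝ, E) Q).isOpen_baseSet
  indexAt := (tangentBundleCore 𝓘(ℝ, E) Q).indexAt
  mem_baseSet_at := (tangentBundleCore 𝓘(ℝ, E) Q).mem_baseSet_at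
  coordChange i j x := ContinuousLinearMap.piMap fun _ : Fin k =>
    (tangentBundleCore 𝓘(ℝ, E) Q).coordChange i j x
  coordChange_self i x hx v := by
    funext a
    exact (tangentBundleCore 𝓘(ℝ, E) Q).coordChange_self i x hx (v a)
  continuousOn_coordChange i j := by
    obtain ⟨D, hD⟩ := exists_clm_piMap (E := E) k
    refine (D.continuous.comp_continuousOn
      ((tangentBundleCore 𝓘(ℝ, E) Q).continuousOn_coordChange i j)).congr fun x _ => ?_
    exact (hD _).symm
  coordChange_comp i j l x hx v := by
    funext a
    exact (tangentBundleCore 𝓘(ℝ, E) Q).coordChange_comp i j l x hx (v a)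

instance (k : ℕ) [IsManifold 𝓘(ℝ, E) 1 Q] : TopologicalSpace (KTangentBundle E Q k) :=
  inferInstanceAs <| TopologicalSpace (kTangentCore E Q k).TotalSpace

instance (k : ℕ) [IsManifold 𝓘(ℝ, E) 1 Q] :
    FiberBundle (Fin k → E) (KTangentSpace E k : Q → Type _) :=
  inferInstanceAs <| FiberBundle (Fin k → E) (kTangentCore E Q k).Fiber

instance (k : ℕ) [IsManifold 𝓘(ℝ, E) 1 Q] :
    VectorBundle ℝ (Fin k → E) (KTangentSpace E k : Q → Type _) :=
  inferInstanceAs <| VectorBundle ℝ (Fin k → E) (kTangentCore E Q k).Fiber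

instance (k : ℕ) [IsManifold 𝓘(ℝ, E) ∞ Q] :
    (kTangentCore E Q k).IsContMDiff 𝓘(ℝ, E) ∞ := by
  have : IsManifold 𝓘(ℝ, E) (∞ + 1) Q := ‹IsManifold 𝓘(ℝ, E) ∞ Q›
  have h : (tangentBundleCore 𝓘(ℝ, E) Q).IsContMDiff 𝓘(ℝ, E) ∞ := tangentBundleCore.isContMDiff
  obtain ⟨D, hD⟩ := exists_clm_piMap (E := E) k
  refine ⟨fun i j => ?_⟩
  refine (D.contMDiff.comp_contMDiffOn (h.contMDiffOn_coordChange i j)).congr fun x _ => ?_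
  exact (hD _).symm

instance (k : ℕ) [IsManifold 𝓘(ℝ, E) ∞ Q] :
    ContMDiffVectorBundle ∞ (Fin k → E) (KTangentSpace E k : Q → Type _) 𝓘(ℝ, E) :=
  inferInstanceAs <| ContMDiffVectorBundle ∞ (Fin k → E) (kTangentCore E Q k).Fiber 𝓘(ℝ, E)

end KTangentBundle

/-! ### Exterior derivative of a 1-form -/

section ExteriorDerivative

variable {V : Type*} [NormedAddCommGroup V] [NormedSpace ℝ V] {H : Type*} [TopologicalSpace H]
  (I : ModelWithCorners ℝ V H) {N : Type*} [TopologicalSpace N] [ChartedSpace H N]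

/-- The expression in the chart `φ` around `x` of a 1-form `θ`, that is `(φ⁻¹)^* θ`. -/
def oneFormInChart (θ : (y : N) → TangentSpace I y →L[ℝ] ℝ) (x : N) (p : V) : V →L[ℝ] ℝ :=
  (θ ((extChartAt I x).symm p)).comp (mfderiv 𝓘(ℝ, V) I (extChartAt I x).symm p)

/-- The exterior derivative of a 1-form on a boundaryless manifold. In the chart `φ` around `x`,
with `θ' = (φ⁻¹)^* θ`, one has `dθ'(u, w) = D θ'(u)(w) - D θ'(w)(u)`, and
`(dθ)ₓ = φ^* (dθ')`. -/
def extDerivOneForm (θ : (y : N) → TangentSpace I y →L[ℝ] ℝ) (x : N) :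
    TangentSpace I x →L[ℝ] TangentSpace I x →L[ℝ] ℝ :=
  let D : V →L[ℝ] V →L[ℝ] ℝ := fderiv ℝ (oneFormInChart I θ x) (extChartAt I x x)
  let T : V →L[ℝ] V := mfderiv I 𝓘(ℝ, V) (extChartAt I x) x
  let d : V →L[ℝ] V →L[ℝ] ℝ := (D - D.flip).bilinearComp T T
  d

end ExteriorDerivative

/-! ### Canonical structures of the `k`-tangent bundle and Lagrangian field theory -/

section Lagrangian

variable {E : Type*} [NormedAddCommGroup E] [NormedSpace ℝ E]
  {Q : Type*} [TopologicalSpace Q] [ChartedSpace E Q] [IsManifold 𝓘(ℝ, E) ∞ Q] {k : ℕ}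

/-- The model of the manifold `T¹ₖQ`. -/
abbrev kModel (E : Type*) [NormedAddCommGroup E] [NormedSpace ℝ E] (k : ℕ) :
    ModelWithCorners ℝ (E × (Fin k → E)) (ModelProd E (Fin k → E)) :=
  𝓘(ℝ, E).prod 𝓘(ℝ, Fin k → E)

/-- The tangent space of `T¹ₖQ` at a point. -/
abbrev TT (x : KTangentBundle E Q k) : Type _ := TangentSpace (kModel E k) x

/-- The projection `π : T¹ₖQ → Q`. -/
abbrev proj (x : KTangentBundle E Q k) : Q := x.proj

/-- The tangent map of `π`. -/
def dproj (x : KTangentBundle E Q k) : TT x →L[ℝ] TangentSpace 𝓘(ℝ, E) x.proj :=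
  mfderiv (kModel E k) 𝓘(ℝ, E) (proj (E := E) (Q := Q) (k := k)) x

/-- The inclusion of the fibre over `q`. -/
def fibreInclusion (q : Q) (v : Fin k → E) : KTangentBundle E Q k :=
  ⟨q, (v : KTangentSpace E k q)⟩

/-- The vertical `α`-lift of `w ∈ T_qQ` to the point `x = (q; v₁, …, vₖ)`: the velocity at `t = 0`
of the curve `(q; v₁, …, v_α + t w, …, vₖ)` in the fibre over `q`. -/
def verticalLift (a : Fin k) (x : KTangentBundle E Q k) :
    TangentSpace 𝓘(ℝ, E) x.proj →L[ℝ] TT x :=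
  let ι : (Fin k → E) →L[ℝ] TT x :=
    mfderiv 𝓘(ℝ, Fin k → E) (kModel E k)
      (fibreInclusion (E := E) (k := k) x.proj) x.snd
  let s : TangentSpace 𝓘(ℝ, E) x.proj →L[ℝ] (Fin k → E) :=
    ContinuousLinearMap.single ℝ (fun _ : Fin k => E) a
  ι.comp s

/-- The vertical endomorphism `J^α`. -/
def vertEndo (a : Fin k) (x : KTangentBundle E Q k) : TT x →L[ℝ] TT x :=
  (verticalLift a x).comp (dproj x)

/-- The Liouville vector field `Δ = ∑_α (v_α)^{∧α}`. -/
def liouville (x : KTangentBundle E Q k) : TT x := ∑ a, verticalLift a x (x.snd a)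

/-- The differential of a function on `T¹ₖQ`. -/
def dFun (f : KTangentBundle E Q k → ℝ) (x : KTangentBundle E Q k) : TT x →L[ℝ] ℝ :=
  mfderiv (kModel E k) 𝓘(ℝ, ℝ) f x

/-- The Cartan 1-form `θ^α_L = dL ∘ J^α`. -/
def cartanOneForm (L : KTangentBundle E Q k → ℝ) (a : Fin k) (x : KTangentBundle E Q k) :
    TT x →L[ℝ] ℝ :=
  (dFun L x).comp (vertEndo a x)

/-- The Cartan 2-form `ω^α_L = -dθ^α_L`. -/
def cartanTwoForm (L : KTangentBundle E Q k → ℝ) (a : Fin k) (x : KTangentBundle E Q k) :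
    TT x →L[ℝ] TT x →L[ℝ] ℝ :=
  -extDerivOneForm (kModel E k) (cartanOneForm L a) x

/-- The Lagrangian energy `E_L = Δ(L) - L`. -/
def energy (L : KTangentBundle E Q k → ℝ) (x : KTangentBundle E Q k) : ℝ :=
  dFun L x (liouville x) - L x

/-- `Ω_L` at a point: `Ω_L(X₁, …, Xₖ) = ∑_α i(X_α) ω^α_L`. -/
def Omega (L : KTangentBundle E Q k → ℝ) (x : KTangentBundle E Q k) (X : Fin k → TT x) :
    TT x →L[ℝ] ℝ :=
  ∑ a, cartanTwoForm L a x (X a)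

/-- A vector field on `T¹ₖQ` (smoothness is `SmoothVF`). -/
abbrev VF (E : Type*) [NormedAddCommGroup E] [NormedSpace ℝ E] (Q : Type*) [TopologicalSpace Q]
    [ChartedSpace E Q] [IsManifold 𝓘(ℝ, E) ∞ Q] (k : ℕ) : Type _ :=
  (x : KTangentBundle E Q k) → TT x

/-- A `k`-vector field on `T¹ₖQ`: a field of `k`-tuples of tangent vectors (smoothness is
`SmoothKVF`). -/
abbrev KVF (E : Type*) [NormedAddCommGroup E] [NormedSpace ℝ E] (Q : Type*) [TopologicalSpace Q]
    [ChartedSpace E Q] [IsManifold 𝓘(ℝ, E) ∞ Q] (k : ℕ) : Type _ :=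
  (x : KTangentBundle E Q k) → Fin k → TT x

/-- The vector field `Z` is smooth. -/
def SmoothVF (Z : VF E Q k) : Prop :=
  ContMDiff (kModel E k) (kModel E k).tangent ∞
    fun x => (⟨x, Z x⟩ : TangentBundle (kModel E k) (KTangentBundle E Q k))

/-- The `k`-vector field `X = (X₁, …, Xₖ)` is smooth. -/
def SmoothKVF (X : KVF E Q k) : Prop := ∀ a, SmoothVF fun x => X x a

/-- `X` is a SOPDE: a section of `T¹ₖπ`, that is `Tπ (X_α(q; v)) = v_α`. -/
def IsSopde (X : KVF E Q k) : Prop := ∀ x a, dproj x (X x a) = x.snd a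

/-- A `k`-tuple of tangent vectors at `x` that are vertical for `π`. -/
def IsVerticalAt (x : KTangentBundle E Q k) (v : Fin k → TT x) : Prop := ∀ a, dproj x (v a) = 0

/-- The `k`-tuple `X` of tangent vectors at `x` satisfies the Lagrangian equation
`∑_α i(X_α) ω^α_L = dE_L` at `x`. -/
def LagrangianEqAt (L : KTangentBundle E Q k → ℝ) (x : KTangentBundle E Q k)
    (X : Fin k → TT x) : Prop :=
  Omega L x X = dFun (energy L) x

/-- `P₁`: the points at which `dE_L` is in the image of `Ω_L`. -/
def P1 (L : KTangentBundle E Q k → ℝ) : Set (KTangentBundle E Q k) :=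
  {x | ∃ X : Fin k → TT x, LagrangianEqAt L x X}

/-- `S₁`: the points `x` of `P₁` at which a solution `X` of the Lagrangian equation can be
corrected by an element `Y` of the kernel of `Ω_L` so that the second order condition
`∑_α J^α (X_α + Y_α) = Δ` holds at `x`. -/
def S1 (L : KTangentBundle E Q k → ℝ) (X : KVF E Q k) : Set (KTangentBundle E Q k) :=
  {x | x ∈ P1 L ∧ ∃ Y : Fin k → TT x, Omega L x Y = 0 ∧
    ∑ a, vertEndo a x (X x a + Y a) = liouville x}

/-- The annihilator `𝔖^⊥` of a set `𝔖` of `k`-vector fields: the smooth vector fields `Z` with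
`Ω_L(V)(Z) = 0` for every `V ∈ 𝔖`. -/
def annihilator (L : KTangentBundle E Q k → ℝ) (S : Set (KVF E Q k)) : Set (VF E Q k) :=
  {Z | SmoothVF Z ∧ ∀ V ∈ S, ∀ x, Omega L x (V x) (Z x) = 0}

/-- The smooth vertical `k`-vector fields. -/
def verticalKVF (E : Type*) [NormedAddCommGroup E] [NormedSpace ℝ E] (Q : Type*)
    [TopologicalSpace Q] [ChartedSpace E Q] [IsManifold 𝓘(ℝ, E) ∞ Q] (k : ℕ) : Set (KVF E Q k) :=
  {V | SmoothKVF V ∧ ∀ x, IsVerticalAt x (V x)}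

/-- `𝔐`: the annihilator of the vertical `k`-vector fields. -/
def frakM (L : KTangentBundle E Q k → ℝ) : Set (VF E Q k) := annihilator L (verticalKVF E Q k)

/-- `𝔐ₓ`: the annihilator at the point `x` of the vertical `k`-tuples of tangent vectors. -/
def frakMAt (L : KTangentBundle E Q k → ℝ) (x : KTangentBundle E Q k) : Submodule ℝ (TT x) where
  carrier := {z | ∀ v : Fin k → TT x, IsVerticalAt x v → Omega L x v z = 0}
  add_mem' {z w} hz hw v hv := by rw [map_add, hz v hv, hw v hv, add_zero]
  zero_mem' v _ := map_zero _
  smul_mem' c z hz v hv := by rw [map_smul, hz v hv, smul_zero]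

/-- The points `x` of `P₁` with `Ω_L(Y)ₓ(z) = 0` for every `z ∈ 𝔐ₓ`. -/
def constraintSet (L : KTangentBundle E Q k → ℝ) (Y : KVF E Q k) : Set (KTangentBundle E Q k) :=
  {x | x ∈ P1 L ∧ ∀ z ∈ frakMAt L x, Omega L x (Y x) z = 0}

/-- The points `x` of `P₁` with `(i(Z) Ω_L(Y))(x) = 0` for every vector field `Z ∈ 𝔐`. -/
def fieldConstraintSet (L : KTangentBundle E Q k → ℝ) (Y : KVF E Q k) :
    Set (KTangentBundle E Q k) :=
  {x | x ∈ P1 L ∧ ∀ Z ∈ frakM L, Omega L x (Y x) (Z x) = 0}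

end Lagrangian

end KSymplectic

end

/-! At a point, the second order tuples form an affine space over the vertical tuples, and `X + Y`
picks one of them. On `P1` the tuple `X + Y + v` solves the Lagrangian equation iff `Ω(v) = -Ω(Y)`,
so `x ∈ S1` means that `Ω(Y)` lies in the image under `Ω` of the vertical tuples (`mem_S1_iff`). In
finite dimensions this subspace of the dual is the annihilator of its coannihilator, which is `𝔐ₓ`;
this is the description by `𝔐ₓ` (`S1_eq_constraintSet`). Every vertical tuple at a point extends to
a smooth vertical field, which gives pointwise maximality and the inclusion for fields in `𝔐`.

For the constant-dimension statements, `𝔐_y` is written in coordinates as the kernel of a smooth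
matrix `B_y`. Constant nullity yields a smooth local `P` with `B P B = B`
(`exists_smooth_generalizedInverse`), used twice. The map `1 - P B` takes values in the kernel, so
elements of `𝔐ₓ` extend to fields in `𝔐`. Dually, a covector `λ` vanishing on the kernel satisfies
`λ = (λ P) B`, so `Ω(V) = -Ω(Y)` has local solutions with smooth coefficients `-λ P`. This equation
is affine in `V`, hence a partition of unity glues the local solutions when `P1`, and therefore
`S1`, is closed.

Smoothness of `B` needs smoothness of `dθ`. Since `extDerivOneForm` uses a chart that changes with
the point, it is derived from the formula for `dθ(A, B)` through the Lie bracket. -/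

noncomputable section

namespace KSymplectic

/-! ### Generalized inverses of maps of constant rank -/

section ConstantRank

variable {V U : Type*} [NormedAddCommGroup V] [NormedSpace ℝ V] [FiniteDimensional ℝ V]
  [NormedAddCommGroup U] [NormedSpace ℝ U] [FiniteDimensional ℝ U]

/-- A linear map between finite-dimensional spaces has a reflexive generalized inverse. -/
theorem exists_reflexive_generalizedInverse (B : V →L[ℝ] U) :
    ∃ G : U →L[ℝ] V, (∀ v, B (G (B v)) = B v) ∧ ∀ u, G (B (G u)) = G u := by
  let b : V →ₗ[ℝ] U := B
  -- The inverse is `h ∘ p`, with `h` a linear section of `B` over its range and `p` a linear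
  -- retraction of `U` onto the range.
  obtain ⟨h, hh⟩ := b.rangeRestrict.exists_rightInverse_of_surjective b.range_rangeRestrict
  obtain ⟨p, hp⟩ := (LinearMap.range b).subtype.exists_leftInverse_of_injective
    (Submodule.ker_subtype _)
  have hh' : ∀ w : LinearMap.range b, B (h w) = w := fun w =>
    congrArg Subtype.val (LinearMap.congr_fun hh w)
  have hp' : ∀ w : LinearMap.range b, p w = w := fun w => LinearMap.congr_fun hp w
  refine ⟨LinearMap.toContinuousLinearMap (h ∘ₗ p), fun v => ?_, fun u => ?_⟩
  · have := hp' ⟨B v, v, rfl⟩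
    simp only [LinearMap.coe_toContinuousLinearMap', LinearMap.comp_apply]
    rw [show p (B v) = _ from this, hh']
  · simp only [LinearMap.coe_toContinuousLinearMap', LinearMap.comp_apply]
    rw [hh', hp']

variable {W : Type*} [NormedAddCommGroup W] [NormedSpace ℝ W] {H : Type*} [TopologicalSpace H]
  {I : ModelWithCorners ℝ W H} {N : Type*} [TopologicalSpace N] [ChartedSpace H N]

/-- A smooth family of linear maps whose kernels have constant dimension near `x₀` has, near `x₀`,
a smooth family of generalized inverses. -/
theorem exists_smooth_generalizedInverse {B : N → V →L[ℝ] U}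
    (hB : ContMDiff I 𝓘(ℝ, V →L[ℝ] U) ∞ B) {x₀ : N}
    (hrank : ∀ᶠ y in 𝓝 x₀, Module.finrank ℝ (LinearMap.ker (B y).toLinearMap) =
      Module.finrank ℝ (LinearMap.ker (B x₀).toLinearMap)) :
    ∃ (P : N → U →L[ℝ] V) (O : Set N), IsOpen O ∧ x₀ ∈ O ∧
      ContMDiffOn I 𝓘(ℝ, U →L[ℝ] V) ∞ P O ∧ ∀ y ∈ O, ∀ v, B y (P y (B y v)) = B y v := by
  have : CompleteSpace U := FiniteDimensional.complete ℝ U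
  obtain ⟨G, hG₁, hG₂⟩ := exists_reflexive_generalizedInverse (B x₀)
  -- This choice gives `A x₀ = 1`, so `A` is invertible near `x₀`, and `B y ∘ G = A y ∘ B x₀ ∘ G`
  -- because `G ∘ B x₀ ∘ G = G`. The generalized inverse is `G ∘ (A y)⁻¹`.
  let A : N → U →L[ℝ] U := fun y => 1 + (B y - B x₀).comp G
  have hA : ContMDiff I 𝓘(ℝ, U →L[ℝ] U) ∞ A :=
    contMDiff_const.add ((hB.sub contMDiff_const).clm_comp contMDiff_const)
  have hA₀ : A x₀ = 1 := by simp [A]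
  have hunit : ∀ᶠ y in 𝓝 x₀, IsUnit (A y) :=
    hA.continuous.continuousAt.eventually
      (Units.isOpen.mem_nhds (show IsUnit (A x₀) by rw [hA₀]; exact isUnit_one))
  obtain ⟨O, hO, hOo, hx₀⟩ := eventually_nhds_iff.1 (hrank.and hunit)
  refine ⟨fun y => G.comp (Ring.inverse (A y)), O, hOo, hx₀, fun y hy => ?_, fun y hy v => ?_⟩
  · obtain ⟨a, ha⟩ := (hO y hy).2
    have h₁ : ContMDiffAt I 𝓘(ℝ, U →L[ℝ] U) ∞ (fun y => Ring.inverse (A y)) y :=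
      ContMDiffAt.comp (I' := 𝓘(ℝ, U →L[ℝ] U)) y
        (ha ▸ (contDiffAt_ringInverse ℝ a).contMDiffAt) hA.contMDiffAt
    exact (contMDiffAt_const.clm_comp h₁).contMDiffWithinAt
  · obtain ⟨hr, hu⟩ := hO y hy
    have hAinj : ∀ u, Ring.inverse (A y) (A y u) = u := fun u => by
      rw [← mul_apply_eq_comp, Ring.inverse_mul_cancel _ hu,
        one_apply_eq_self]
    have hBG : ∀ u, B y (G u) = A y (B x₀ (G u)) := fun u => by simp [A, hG₂]
    let bG : U →ₗ[ℝ] U := (B y).toLinearMap ∘ₗ G.toLinearMap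
    let b₀ : V →ₗ[ℝ] U := (A y).toLinearMap ∘ₗ (B x₀).toLinearMap
    have h₁ : LinearMap.range bG = LinearMap.range b₀ := by
      apply le_antisymm
      · rintro _ ⟨u, rfl⟩
        exact ⟨G u, (hBG u).symm⟩
      · rintro _ ⟨w, rfl⟩
        exact ⟨B x₀ w, by simp [bG, b₀, hBG, hG₁]⟩
    have hker : LinearMap.ker b₀ = LinearMap.ker (B x₀).toLinearMap := by
      apply LinearMap.ker_comp_of_ker_eq_bot
      exact LinearMap.ker_eq_bot.2 (Function.LeftInverse.injective hAinj)
    -- Constant rank enters here: `B y ∘ G` has the range of `A y ∘ B x₀`, whose dimension is the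
    -- rank of `B x₀`, hence that of `B y`. Every value of `B y` is therefore some `B y (G u)`.
    have h₂ : LinearMap.range bG = LinearMap.range (B y).toLinearMap := by
      apply Submodule.eq_of_le_of_finrank_eq
      · rintro _ ⟨u, rfl⟩
        exact ⟨G u, rfl⟩
      · have e₁ := LinearMap.finrank_range_add_finrank_ker (B y).toLinearMap
        have e₂ := LinearMap.finrank_range_add_finrank_ker b₀
        rw [hker] at e₂
        rw [h₁]
        omega
    obtain ⟨u, hu'⟩ : B y v ∈ LinearMap.range bG := h₂ ▸ ⟨v, rfl⟩
    have hv : B y v = A y (B x₀ (G u)) := hu'.symm.trans (hBG u)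
    simp only [ContinuousLinearMap.comp_apply]
    rw [hv, hAinj, hBG, hG₂]

end ConstantRank

/-! ### Coordinate vector fields -/

section CoordinateFields

variable {V : Type*} [NormedAddCommGroup V] [NormedSpace ℝ V]
  {H : Type*} [TopologicalSpace H]
  (I : ModelWithCorners ℝ V H) {N : Type*} [TopologicalSpace N] [ChartedSpace H N]

section Definition

variable [IsManifold I 1 N]

/-- The coordinate expression, in the preferred chart at `x₀`, of tangent vectors at `y`. -/
def tangentCoord (x₀ y : N) : TangentSpace I y →L[ℝ] V :=
  (trivializationAt V (TangentSpace I) x₀).continuousLinearMapAt ℝ y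

variable {I}

theorem mem_baseSet_trivializationAt_tangent {x₀ y : N} (hy : y ∈ (chartAt H x₀).source) :
    y ∈ (trivializationAt V (TangentSpace I : N → Type _) x₀).baseSet := hy

theorem tangentCoord_injective {x₀ y : N} (hy : y ∈ (chartAt H x₀).source) :
    Function.Injective (tangentCoord I x₀ y) :=
  Function.LeftInverse.injective fun v =>
    (trivializationAt V (TangentSpace I : N → Type _) x₀).symmL_continuousLinearMapAt
      (R := ℝ) (mem_baseSet_trivializationAt_tangent hy) v

variable [FiniteDimensional ℝ V]

variable (I) in
/-- A smooth bump function supported in the preferred chart at `x₀`. -/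
def chartBump (x₀ : N) : SmoothBumpFunction I x₀ := Classical.arbitrary _

variable (I) in
/-- The tangent vector at `y` with given coordinates in the preferred chart at `x₀`, multiplied
by a bump function that is supported in the domain of this chart. -/
def coordField (x₀ y : N) : V →L[ℝ] TangentSpace I y :=
  (chartBump I x₀) y •
    (trivializationAt V (TangentSpace I) x₀).symmL ℝ y

theorem tangentCoord_coordField {x₀ y : N} (hy : y ∈ (chartAt H x₀).source) (v : V) :
    tangentCoord I x₀ y (coordField I x₀ y v) = (chartBump I x₀) y • v := by
  simp only [tangentCoord, coordField, smul_apply, map_smul]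
  rw [Bundle.Trivialization.continuousLinearMapAt_symmL _
    (mem_baseSet_trivializationAt_tangent hy)]

theorem coordField_eq_zero {x₀ y : N} (hy : y ∉ (chartAt H x₀).source) (v : V) :
    coordField I x₀ y v = 0 := by
  have : (chartBump I x₀) y = 0 := by
    by_contra h
    exact hy ((chartBump I x₀).support_subset_source h)
  simp [coordField, this]

variable (I) in
/-- Near `x₀`, `coordField I x₀` and `tangentCoord I x₀` are inverse to each other. -/
theorem eventually_coordField (x₀ : N) : ∀ᶠ y in 𝓝 x₀, y ∈ (chartAt H x₀).source ∧
    (∀ v, tangentCoord I x₀ y (coordField I x₀ y v) = v) ∧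
    ∀ z, coordField I x₀ y (tangentCoord I x₀ y z) = z := by
  filter_upwards [(chartBump I x₀).eventuallyEq_one,
    chart_source_mem_nhds H x₀] with y hy hs
  have h : ∀ v, tangentCoord I x₀ y (coordField I x₀ y v) = v := fun v => by
    rw [tangentCoord_coordField hs, hy, Pi.one_apply, one_smul]
  exact ⟨hs, h, fun z => tangentCoord_injective hs (h _)⟩

end Definition

variable {I} [IsManifold I ∞ N]

theorem contMDiffAt_section_iff_tangentCoord {Z : (y : N) → TangentSpace I y} {x₀ y : N}
    (hy : y ∈ (chartAt H x₀).source) :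
    ContMDiffAt I I.tangent ∞ (fun y => (⟨y, Z y⟩ : TangentBundle I N)) y ↔
      ContMDiffAt I 𝓘(ℝ, V) ∞ (fun y => tangentCoord I x₀ y (Z y)) y := by
  have : IsManifold I (∞ + 1) N := ‹IsManifold I ∞ N›
  have h := mem_baseSet_trivializationAt_tangent (I := I) hy
  rw [(trivializationAt V (TangentSpace I : N → Type _) x₀).contMDiffAt_section_iff h]
  refine Filter.EventuallyEq.contMDiffAt_iff ?_
  filter_upwards [(chartAt H x₀).open_source.mem_nhds hy] with w hw
  rw [tangentCoord, Bundle.Trivialization.continuousLinearMapAt_apply,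
    Bundle.Trivialization.coe_linearMapAt_of_mem _ (mem_baseSet_trivializationAt_tangent hw)]

/-- The directional derivative of a smooth function along a smooth vector field is smooth. -/
theorem contMDiff_mfderiv_apply {f : N → ℝ} (hf : ContMDiff I 𝓘(ℝ, ℝ) ∞ f)
    {Z : (y : N) → TangentSpace I y}
    (hZ : ContMDiff I I.tangent ∞ fun y => (⟨y, Z y⟩ : TangentBundle I N)) :
    ContMDiff I 𝓘(ℝ, ℝ) ∞ fun y => (mfderiv I 𝓘(ℝ, ℝ) f y (Z y) : ℝ) :=
  (contMDiff_snd_tangentBundle_modelSpace ℝ 𝓘(ℝ, ℝ)).comp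
    ((hf.contMDiff_tangentMap (m := ∞) le_rfl).comp hZ)

variable [FiniteDimensional ℝ V]

/-- In the chart the field is the bump function times `u`. Off the chart domain it vanishes near
`y`, since in a Hausdorff manifold the closed support of the bump stays inside the domain. -/
theorem contMDiffAt_coordField [T2Space N] (x₀ : N) {u : N → V} {y : N}
    (hu : ContMDiffAt I 𝓘(ℝ, V) ∞ u y) :
    ContMDiffAt I I.tangent ∞ (fun y => (⟨y, coordField I x₀ y (u y)⟩ : TangentBundle I N)) y := by
  let f := chartBump I x₀
  by_cases hy : y ∈ (chartAt H x₀).source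
  · rw [contMDiffAt_section_iff_tangentCoord hy]
    refine (f.contMDiff.contMDiffAt.smul hu).congr_of_eventuallyEq ?_
    filter_upwards [(chartAt H x₀).open_source.mem_nhds hy] with w hw
    exact tangentCoord_coordField hw _
  · have hy' : y ∉ tsupport f := fun h => hy (f.tsupport_subset_chartAt_source h)
    refine (contMDiff_zeroSection ℝ (TangentSpace I : N → Type _)).contMDiffAt.congr_of_eventuallyEq
      ?_
    filter_upwards [(isClosed_tsupport f).isOpen_compl.mem_nhds hy'] with w hw
    have : (chartBump I x₀) w = 0 := image_eq_zero_of_notMem_tsupport hw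
    simp [coordField, this, zeroSection]

theorem contMDiff_coordField [T2Space N] (x₀ : N) (v : V) :
    ContMDiff I I.tangent ∞ (fun y => (⟨y, coordField I x₀ y v⟩ : TangentBundle I N)) :=
  fun _ => contMDiffAt_coordField x₀ contMDiffAt_const

end CoordinateFields

/-! ### The exterior derivative of a 1-form on pairs of vector fields -/

section ExteriorDerivativeFormula

open VectorField

variable {V : Type*} [NormedAddCommGroup V] [NormedSpace ℝ V] {H : Type*} [TopologicalSpace H]
  {I : ModelWithCorners ℝ V H} [I.Boundaryless]
  {N : Type*} [TopologicalSpace N] [ChartedSpace H N]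

theorem oneFormInChart_extChartAt_self [IsManifold I 1 N]
    (θ : (y : N) → TangentSpace I y →L[ℝ] ℝ) (x : N) (v : V) :
    oneFormInChart I θ x (extChartAt I x x) v = θ x v := by
  have h₁ : mfderiv 𝓘(ℝ, V) I (extChartAt I x).symm (extChartAt I x x) =
      ContinuousLinearMap.id ℝ V := by
    have := mfderivWithin_range_extChartAt_symm (I := I) (x := x)
    rwa [I.range_eq_univ, mfderivWithin_univ] at this
  -- The base point `φ⁻¹ (φ x)` equals `x` only propositionally; since every tangent space is the
  -- type `V`, the comparison can be made by substitution.
  have h₂ : ∀ y, y = x → θ y (v : V) = θ x v := by rintro _ rfl; rfl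
  have h₃ : oneFormInChart I θ x (extChartAt I x x) v =
      θ ((extChartAt I x).symm (extChartAt I x x))
        (mfderiv 𝓘(ℝ, V) I (extChartAt I x).symm (extChartAt I x x) v) := rfl
  rw [h₃, h₁]
  exact h₂ _ (extChartAt_to_inv x)

/-- The expression of the vector field `Z` in the chart around `x`. -/
def vectorFieldInChart (I : ModelWithCorners ℝ V H) (Z : (y : N) → TangentSpace I y) (x : N) :
    V → V :=
  mpullback 𝓘(ℝ, V) I (extChartAt I x).symm Z

/-- The differential of a real function. -/
def differential (I : ModelWithCorners ℝ V H) (f : N → ℝ) (y : N) : TangentSpace I y →L[ℝ] ℝ :=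
  mfderiv I 𝓘(ℝ, ℝ) f y

theorem oneFormInChart_vectorFieldInChart [IsManifold I 1 N]
    (θ : (y : N) → TangentSpace I y →L[ℝ] ℝ) (x : N) (Z : (y : N) → TangentSpace I y) {p : V}
    (hp : p ∈ (extChartAt I x).target) :
    oneFormInChart I θ x p (vectorFieldInChart I Z x p) =
      θ ((extChartAt I x).symm p) (Z ((extChartAt I x).symm p)) := by
  have h : (mfderiv 𝓘(ℝ, V) I (extChartAt I x).symm p).IsInvertible := by
    have := isInvertible_mfderivWithin_extChartAt_symm (I := I) hp
    rwa [I.range_eq_univ, mfderivWithin_univ] at this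
  have := h.self_apply_inverse (Z ((extChartAt I x).symm p))
  exact congrArg (θ ((extChartAt I x).symm p)) this

theorem vectorFieldInChart_extChartAt_self [IsManifold I 1 N]
    (Z : (y : N) → TangentSpace I y) (x : N) :
    vectorFieldInChart I Z x (extChartAt I x x) = Z x := by
  have h₁ : mfderiv 𝓘(ℝ, V) I (extChartAt I x).symm (extChartAt I x x) =
      ContinuousLinearMap.id ℝ V := by
    have := mfderivWithin_range_extChartAt_symm (I := I) (x := x)
    rwa [I.range_eq_univ, mfderivWithin_univ] at this
  have h₂ : ∀ y, y = x → (Z y : V) = Z x := by rintro _ rfl; rfl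
  have h₃ : (mfderiv 𝓘(ℝ, V) I (extChartAt I x).symm (extChartAt I x x)).IsInvertible := by
    have := isInvertible_mfderivWithin_extChartAt_symm (I := I) (mem_extChartAt_target x)
    rwa [I.range_eq_univ, mfderivWithin_univ] at this
  have h₄ := h₃.self_apply_inverse (Z ((extChartAt I x).symm (extChartAt I x x)))
  have h₅ : ∀ w : V, (mfderiv 𝓘(ℝ, V) I (extChartAt I x).symm (extChartAt I x x) : V → V) w = w :=
    fun w => congrArg (fun f : V →L[ℝ] V => f w) h₁
  exact ((h₅ _).symm.trans h₄).trans (h₂ _ (extChartAt_to_inv x))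

theorem mpullbackWithin_range_eq (Z : (y : N) → TangentSpace I y) (x : N) :
    mpullbackWithin 𝓘(ℝ, V) I (extChartAt I x).symm Z (range I) = vectorFieldInChart I Z x := by
  rw [I.range_eq_univ, mpullbackWithin_univ, vectorFieldInChart]

theorem mlieBracket_eq_lieBracket [IsManifold I 1 N]
    (A B : (y : N) → TangentSpace I y) (x : N) :
    mlieBracket I A B x = lieBracket ℝ (vectorFieldInChart I A x) (vectorFieldInChart I B x)
      (extChartAt I x x) := by
  have h : ((mfderiv I 𝓘(ℝ, V) (extChartAt I x) x).inverse : V →L[ℝ] V) =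
      ContinuousLinearMap.id ℝ V := by
    rw [mfderiv_extChartAt_self]
    exact ContinuousLinearMap.inverse_id
  -- Generalizing the fields, the set and the inverse differential allows all four equations to be
  -- substituted despite the dependent types.
  have key : ∀ (s : Set V) (A₁ B₁ : V → V) (T : V →L[ℝ] V), A₁ = vectorFieldInChart I A x →
      B₁ = vectorFieldInChart I B x → s = univ → T = ContinuousLinearMap.id ℝ V →
      T (lieBracketWithin ℝ A₁ B₁ s (extChartAt I x x)) =
        lieBracket ℝ (vectorFieldInChart I A x) (vectorFieldInChart I B x)
          (extChartAt I x x) := by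
    rintro _ _ _ _ rfl rfl rfl rfl
    rw [lieBracketWithin_univ]
    rfl
  exact key _ _ _ _ (mpullbackWithin_range_eq A x) (mpullbackWithin_range_eq B x)
    (by rw [preimage_univ, univ_inter, I.range_eq_univ]) h

variable [CompleteSpace V] [IsManifold I ∞ N]

theorem differentiableAt_vectorFieldInChart {Z : (y : N) → TangentSpace I y} {x : N}
    (hZ : MDifferentiableAt I I.tangent (fun y => (⟨y, Z y⟩ : TangentBundle I N)) x) :
    DifferentiableAt ℝ (vectorFieldInChart I Z x) (extChartAt I x x) := by
  have key : ∀ (s : Set V) (Z₁ : V → V), Z₁ = vectorFieldInChart I Z x → s = univ →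
      DifferentiableWithinAt ℝ Z₁ s (extChartAt I x x) →
      DifferentiableAt ℝ (vectorFieldInChart I Z x) (extChartAt I x x) := by
    rintro _ _ rfl rfl h
    exact differentiableWithinAt_univ.1 h
  exact key _ _ (mpullbackWithin_range_eq Z x)
    (by rw [preimage_univ, univ_inter, I.range_eq_univ])
    ((mdifferentiableWithinAt_univ.2 hZ).differentiableWithinAt_mpullbackWithin_vectorField)

/-- The derivative of `θ(Z)` expressed in the chart around `x`. -/
theorem differential_oneForm_apply {θ : (y : N) → TangentSpace I y →L[ℝ] ℝ}
    {Z : (y : N) → TangentSpace I y} {x : N}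
    (hθ : DifferentiableAt ℝ (oneFormInChart I θ x) (extChartAt I x x))
    (hZ : MDifferentiableAt I I.tangent (fun y => (⟨y, Z y⟩ : TangentBundle I N)) x)
    (hθZ : MDifferentiableAt I 𝓘(ℝ, ℝ) (fun y => θ y (Z y)) x) (v : V) :
    differential I (fun y => θ y (Z y)) x v =
      fderiv ℝ (oneFormInChart I θ x) (extChartAt I x x) v (Z x) +
        θ x (fderiv ℝ (vectorFieldInChart I Z x) (extChartAt I x x) v) := by
  have key : ∀ f : V → ℝ, ∀ s : Set V, s = univ →
      f =ᶠ[𝓝 (extChartAt I x x)] (fun p => oneFormInChart I θ x p (vectorFieldInChart I Z x p)) →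
      fderivWithin ℝ f s (extChartAt I x x) v =
        fderiv ℝ (oneFormInChart I θ x) (extChartAt I x x) v
          (vectorFieldInChart I Z x (extChartAt I x x)) +
        oneFormInChart I θ x (extChartAt I x x)
          (fderiv ℝ (vectorFieldInChart I Z x) (extChartAt I x x) v) := by
    rintro f _ rfl hf
    rw [fderivWithin_univ, hf.fderiv_eq,
      (hθ.hasFDerivAt.clm_apply (differentiableAt_vectorFieldInChart hZ).hasFDerivAt).fderiv,
      add_comm]
    rfl
  rw [vectorFieldInChart_extChartAt_self, oneFormInChart_extChartAt_self] at key
  refine (congrArg (fun f : V →L[ℝ] ℝ => f v) hθZ.mfderiv).trans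
    (key _ _ I.range_eq_univ ?_)
  filter_upwards [extChartAt_target_mem_nhds (I := I) x] with p hp
  exact (oneFormInChart_vectorFieldInChart θ x Z hp).symm

/-- `dθ(A, B) = A(θ(B)) - B(θ(A)) - θ([A, B])`. -/
theorem extDerivOneForm_apply {θ : (y : N) → TangentSpace I y →L[ℝ] ℝ}
    {A B : (y : N) → TangentSpace I y} {x : N}
    (hθ : DifferentiableAt ℝ (oneFormInChart I θ x) (extChartAt I x x))
    (hA : MDifferentiableAt I I.tangent (fun y => (⟨y, A y⟩ : TangentBundle I N)) x)
    (hB : MDifferentiableAt I I.tangent (fun y => (⟨y, B y⟩ : TangentBundle I N)) x)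
    (hθA : MDifferentiableAt I 𝓘(ℝ, ℝ) (fun y => θ y (A y)) x)
    (hθB : MDifferentiableAt I 𝓘(ℝ, ℝ) (fun y => θ y (B y)) x) :
    extDerivOneForm I θ x (A x) (B x) =
      differential I (fun y => θ y (B y)) x (A x) -
        differential I (fun y => θ y (A y)) x (B x) - θ x (mlieBracket I A B x) := by
  have key : ∀ (T : V →L[ℝ] V) (D : V →L[ℝ] V →L[ℝ] ℝ) (a b : V),
      T = ContinuousLinearMap.id ℝ V →
      (D - D.flip).bilinearComp T T a b = D a b - D b a := by
    rintro _ D a b rfl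
    rfl
  have hd : extDerivOneForm I θ x (A x) (B x) =
      fderiv ℝ (oneFormInChart I θ x) (extChartAt I x x) (A x) (B x) -
        fderiv ℝ (oneFormInChart I θ x) (extChartAt I x x) (B x) (A x) :=
    key _ _ _ _ mfderiv_extChartAt_self
  have hl : θ x (mlieBracket I A B x) =
      θ x (fderiv ℝ (vectorFieldInChart I B x) (extChartAt I x x) (A x)) -
        θ x (fderiv ℝ (vectorFieldInChart I A x) (extChartAt I x x) (B x)) := by
    have h₁ := mlieBracket_eq_lieBracket A B x
    rw [lieBracket_eq] at h₁
    have h₂ := vectorFieldInChart_extChartAt_self (I := I) A x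
    have h₃ := vectorFieldInChart_extChartAt_self (I := I) B x
    rw [h₁]
    simp only [h₂, h₃]
    exact map_sub (θ x) _ _
  -- The product rule produces the terms `θ(DB·A)` and `θ(DA·B)`, which cancel against `θ([A, B])`
  -- and leave the antisymmetrized derivative of `θ`.
  have e₁ := differential_oneForm_apply hθ hB hθB (A x)
  have e₂ := differential_oneForm_apply hθ hA hθA (B x)
  rw [hd, hl]
  linear_combination e₂ - e₁

end ExteriorDerivativeFormula

/-! ### Smoothness of the exterior derivative of a smooth 1-form -/

section ExteriorDerivativeSmooth

open VectorField

variable {V : Type*} [NormedAddCommGroup V] [NormedSpace ℝ V] [FiniteDimensional ℝ V]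
  {H : Type*} [TopologicalSpace H]
  {I : ModelWithCorners ℝ V H} {N : Type*} [TopologicalSpace N] [ChartedSpace H N]

/-- Linear maps on a finite-dimensional space are determined, linearly and continuously, by their
values on a basis. -/
theorem exists_clm_eq_sum_basis (V F : Type*) [NormedAddCommGroup V] [NormedSpace ℝ V]
    [FiniteDimensional ℝ V] [NormedAddCommGroup F] [NormedSpace ℝ F] :
    ∃ S : Fin (Module.finrank ℝ V) → F →L[ℝ] V →L[ℝ] F, ∀ f : V →L[ℝ] F,
      f = ∑ i, S i (f (Module.finBasis ℝ V i)) := by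
  let b := Module.finBasis ℝ V
  refine ⟨fun i => ContinuousLinearMap.smulRightL ℝ V F
    (LinearMap.toContinuousLinearMap (b.coord i)), fun f => ?_⟩
  ext v
  conv_lhs => rw [← b.sum_repr v, map_sum]
  simp [b]

theorem contMDiffAt_of_clm_apply {F : Type*} [NormedAddCommGroup F] [NormedSpace ℝ F]
    {f : N → V →L[ℝ] F} {x : N}
    (hf : ∀ v, ContMDiffAt I 𝓘(ℝ, F) ∞ (fun y => f y v) x) :
    ContMDiffAt I 𝓘(ℝ, V →L[ℝ] F) ∞ f x := by
  obtain ⟨S, hS⟩ := exists_clm_eq_sum_basis V F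
  have h : f = fun y => ∑ i, S i (f y (Module.finBasis ℝ V i)) := funext fun y => hS (f y)
  rw [h]
  exact contMDiffAt_finsetSum fun i _ => (S i).contMDiff.contMDiffAt.comp x (hf _)

theorem differentiableAt_of_clm_apply {W F : Type*} [NormedAddCommGroup W] [NormedSpace ℝ W]
    [NormedAddCommGroup F] [NormedSpace ℝ F] {f : W → V →L[ℝ] F} {x : W}
    (hf : ∀ v, DifferentiableAt ℝ (fun y => f y v) x) : DifferentiableAt ℝ f x := by
  obtain ⟨S, hS⟩ := exists_clm_eq_sum_basis V F
  have h : f = fun y => ∑ i, S i (f y (Module.finBasis ℝ V i)) := funext fun y => hS (f y)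
  rw [h]
  exact DifferentiableAt.fun_sum fun i _ => (S i).differentiableAt.comp x (hf _)

variable [I.Boundaryless] [IsManifold I ∞ N] [T2Space N]

/-- Near the centre of the chart, the coordinate field of `v` is the image of the constant vector
`v` under the inverse chart. The `v`-component of the chart expression is thus `θ` on a smooth
field, composed with the inverse chart. -/
theorem differentiableAt_oneFormInChart {θ : (y : N) → TangentSpace I y →L[ℝ] ℝ}
    (hθ : ∀ Z : (y : N) → TangentSpace I y,
      ContMDiff I I.tangent ∞ (fun y => (⟨y, Z y⟩ : TangentBundle I N)) →
      ContMDiff I 𝓘(ℝ, ℝ) ∞ fun y => θ y (Z y)) (x : N) :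
    DifferentiableAt ℝ (oneFormInChart I θ x) (extChartAt I x x) := by
  refine differentiableAt_of_clm_apply fun v => ?_
  have h₁ : ContMDiffAt 𝓘(ℝ, V) 𝓘(ℝ, ℝ) ∞
      ((fun y => θ y (coordField I x y v)) ∘ (extChartAt I x).symm) (extChartAt I x x) :=
    ContMDiffAt.comp (I' := I) _ (hθ _ (contMDiff_coordField x v)).contMDiffAt
      ((contMDiffOn_extChartAt_symm x).contMDiffAt (extChartAt_target_mem_nhds x))
  refine (h₁.contDiffAt.differentiableAt (by simp)).congr_of_eventuallyEq ?_
  have h₂ : ∀ᶠ p in 𝓝 (extChartAt I x x), chartBump I x ((extChartAt I x).symm p) = 1 := by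
    have hc := continuousAt_extChartAt_symm (I := I) x
    rw [ContinuousAt, extChartAt_to_inv] at hc
    exact hc.eventually (chartBump I x).eventuallyEq_one
  filter_upwards [extChartAt_target_mem_nhds (I := I) x, h₂] with p hp hb
  have hs : (extChartAt I x).symm p ∈ (chartAt H x).source := by
    have := (extChartAt I x).map_target hp
    rwa [extChartAt_source] at this
  have h₃ := TangentBundle.symmL_trivializationAt (I := I) hs
  rw [(extChartAt I x).right_inv hp, I.range_eq_univ, mfderivWithin_univ] at h₃
  have h₄ : coordField I x ((extChartAt I x).symm p) v =
      mfderiv 𝓘(ℝ, V) I (extChartAt I x).symm p v := by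
    rw [coordField, hb, one_smul, h₃]
    rfl
  exact congrArg (θ _) h₄.symm

/-- The exterior derivative of a smooth 1-form, evaluated on smooth vector fields, is smooth. -/
theorem contMDiff_extDerivOneForm {θ : (y : N) → TangentSpace I y →L[ℝ] ℝ}
    (hθ : ∀ Z : (y : N) → TangentSpace I y,
      ContMDiff I I.tangent ∞ (fun y => (⟨y, Z y⟩ : TangentBundle I N)) →
      ContMDiff I 𝓘(ℝ, ℝ) ∞ fun y => θ y (Z y))
    {A B : (y : N) → TangentSpace I y}
    (hA : ContMDiff I I.tangent ∞ fun y => (⟨y, A y⟩ : TangentBundle I N))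
    (hB : ContMDiff I I.tangent ∞ fun y => (⟨y, B y⟩ : TangentBundle I N)) :
    ContMDiff I 𝓘(ℝ, ℝ) ∞ fun y => extDerivOneForm I θ y (A y) (B y) := by
  have : CompleteSpace V := FiniteDimensional.complete ℝ V
  have : IsManifold I (minSmoothness ℝ 2) N := by
    rw [minSmoothness_of_isRCLikeNormedField]
    infer_instance
  have : IsManifold I (((⊤ : ℕ∞) : WithTop ℕ∞) + 1) N := ‹IsManifold I ∞ N›
  have hne : (∞ : WithTop ℕ∞) ≠ 0 := by simp
  have hlie : ContMDiff I I.tangent ∞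
      fun y => (⟨y, mlieBracket I A B y⟩ : TangentBundle I N) :=
    ContDiff.mlieBracket_vectorField (m := ⊤) (n := ⊤) hA hB
      (by rw [minSmoothness_of_isRCLikeNormedField]; exact le_rfl)
  -- The right-hand side of the bracket formula is free of charts, so its smoothness in the point is
  -- visible.
  refine ContMDiff.congr (((contMDiff_mfderiv_apply (hθ B hB) hA).sub
    (contMDiff_mfderiv_apply (hθ A hA) hB)).sub (hθ _ hlie)) fun x => ?_
  exact extDerivOneForm_apply (differentiableAt_oneFormInChart hθ x)
    (hA.contMDiffAt.mdifferentiableAt hne) (hB.contMDiffAt.mdifferentiableAt hne)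
    ((hθ A hA).contMDiffAt.mdifferentiableAt hne) ((hθ B hB).contMDiffAt.mdifferentiableAt hne)

end ExteriorDerivativeSmooth

/-! ### The topology of the `k`-tangent bundle -/

section Topology

variable {E : Type*} [NormedAddCommGroup E] [NormedSpace ℝ E]
  {Q : Type*} [TopologicalSpace Q] [ChartedSpace E Q] [IsManifold 𝓘(ℝ, E) ∞ Q] {k : ℕ}

theorem mem_chartAt_source_iff (x y : KTangentBundle E Q k) :
    y ∈ (chartAt (ModelProd E (Fin k → E)) x).source ↔
      y.proj ∈ (chartAt E x.proj).source := by
  have h : y ∈ (trivializationAt (Fin k → E) (KTangentSpace E k : Q → Type _) x.proj).source ↔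
      y.proj ∈ (chartAt E x.proj).source :=
    (trivializationAt (Fin k → E) (KTangentSpace E k : Q → Type _) x.proj).mem_source
  rw [FiberBundle.chartedSpace_chartAt]
  simp only [OpenPartialHomeomorph.trans_source, OpenPartialHomeomorph.prod_source,
    OpenPartialHomeomorph.refl_source, mem_inter_iff, mem_preimage, mem_prod, mem_univ, and_true]
  rw [h]
  refine ⟨fun h => h.1, fun h' => ⟨h', ?_⟩⟩
  have := (trivializationAt (Fin k → E) (KTangentSpace E k : Q → Type _) x.proj).coe_fst (h.2 h')
  exact this ▸ h'

/-- Points over the same base point share a chart, because chart domains are unions of fibres; other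
points are separated in `Q`. -/
instance [T2Space Q] : T2Space (KTangentBundle E Q k) where
  t2 x y hxy := by
    have hc : Continuous (TotalSpace.proj : KTangentBundle E Q k → Q) :=
      FiberBundle.continuous_proj (Fin k → E) (KTangentSpace E k)
    by_cases h : x.proj = y.proj
    · let c := chartAt (ModelProd E (Fin k → E)) x
      have hx : x ∈ c.source := mem_chart_source _ x
      have hy : y ∈ c.source := (mem_chartAt_source_iff x y).2 (h ▸ mem_chart_source E x.proj)
      have : T2Space (ModelProd E (Fin k → E)) := inferInstanceAs (T2Space (E × (Fin k → E)))
      obtain ⟨u, v, hu, hv, hxu, hyv, huv⟩ := t2_separation (fun e => hxy (c.injOn hx hy e))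
      refine ⟨c.source ∩ c ⁻¹' u, c.source ∩ c ⁻¹' v, c.isOpen_inter_preimage hu,
        c.isOpen_inter_preimage hv, ⟨hx, hxu⟩, ⟨hy, hyv⟩, ?_⟩
      exact (huv.preimage c).mono inter_subset_right inter_subset_right
    · exact separated_by_continuous hc h

/-- Needed for partitions of unity. Countably many chart domains cover `Q`, and their preimages are
the chart domains at the corresponding zero vectors. -/
theorem sigmaCompactSpace_kTangentBundle [FiniteDimensional ℝ E] [SecondCountableTopology Q] :
    SigmaCompactSpace (KTangentBundle E Q k) := by
  have : SecondCountableTopology (ModelProd E (Fin k → E)) :=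
    inferInstanceAs (SecondCountableTopology (E × (Fin k → E)))
  have : LocallyCompactSpace (ModelProd E (Fin k → E)) :=
    inferInstanceAs (LocallyCompactSpace (E × (Fin k → E)))
  have : LocallyCompactSpace (KTangentBundle E Q k) :=
    ChartedSpace.locallyCompactSpace (ModelProd E (Fin k → E)) _
  obtain ⟨s, hs, hsQ⟩ := TopologicalSpace.countable_cover_nhds (α := Q)
    (fun q => chart_source_mem_nhds E q)
  have : SecondCountableTopology (KTangentBundle E Q k) := by
    refine ChartedSpace.secondCountable_of_countable_cover (ModelProd E (Fin k → E))
      (s := (fun q => (⟨q, 0⟩ : KTangentBundle E Q k)) '' s) ?_ (hs.image _)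
    refine eq_univ_of_forall fun x => ?_
    have hx : x.proj ∈ ⋃ q ∈ s, (chartAt E q).source := hsQ ▸ mem_univ _
    simp only [mem_iUnion, biUnion_image] at hx ⊢
    obtain ⟨q, hq, h⟩ := hx
    exact ⟨q, hq, (mem_chartAt_source_iff (k := k) ⟨q, 0⟩ x).2 h⟩
  infer_instance

end Topology

/-! ### The canonical structures in coordinates -/

section Coordinates

variable {E : Type*} [NormedAddCommGroup E] [NormedSpace ℝ E]
  {Q : Type*} [TopologicalSpace Q] [ChartedSpace E Q] [IsManifold 𝓘(ℝ, E) ∞ Q] {k : ℕ}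

theorem tangentCoord_eq_mfderiv {V : Type*} [NormedAddCommGroup V] [NormedSpace ℝ V]
    {H : Type*} [TopologicalSpace H] {I : ModelWithCorners ℝ V H} {N : Type*}
    [TopologicalSpace N] [ChartedSpace H N] [IsManifold I 1 N] {x₀ y : N}
    (hy : y ∈ (chartAt H x₀).source) (z : TangentSpace I y) :
    tangentCoord I x₀ y z = mfderiv I 𝓘(ℝ, V) (extChartAt I x₀) y z :=
  congrArg (fun f => f z) (TangentBundle.continuousLinearMapAt_trivializationAt hy)

/-- The cocycle of `T¹ₖQ` is the tangent cocycle acting on each component. -/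
theorem trivializationAt_kTangent_snd (q₀ : Q) {q : Q} (hq : q ∈ (chartAt E q₀).source)
    (v : Fin k → E) (a : Fin k) :
    (trivializationAt (Fin k → E) (KTangentSpace E k : Q → Type _) q₀
      (fibreInclusion (E := E) q v)).2 a = tangentCoord 𝓘(ℝ, E) q₀ q (v a) := by
  have h := TangentBundle.continuousLinearMapAt_trivializationAt_eq_core (I := 𝓘(ℝ, E)) hq
  exact (congrArg (fun f : E →L[ℝ] E => f (v a)) h).symm

theorem extChartAt_kTangent_apply (x₀ y : KTangentBundle E Q k)
    (hy : y.proj ∈ (chartAt E x₀.proj).source) :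
    extChartAt (kModel E k) x₀ y = (extChartAt 𝓘(ℝ, E) x₀.proj y.proj,
      fun a => tangentCoord 𝓘(ℝ, E) x₀.proj y.proj (y.snd a)) := by
  rw [FiberBundle.extChartAt]
  have h₁ := (trivializationAt (Fin k → E) (KTangentSpace E k : Q → Type _) x₀.proj).coe_fst
    ((trivializationAt (Fin k → E) (KTangentSpace E k : Q → Type _) x₀.proj).mem_source.2 hy)
  refine Prod.ext ?_ (funext fun a => trivializationAt_kTangent_snd x₀.proj hy y.snd a)
  exact congrArg (extChartAt 𝓘(ℝ, E) x₀.proj) h₁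

theorem contMDiff_proj_kTangent :
    ContMDiff (kModel E k) 𝓘(ℝ, E) ∞ (proj (E := E) (Q := Q) (k := k)) :=
  Bundle.contMDiff_proj (KTangentSpace E k)

theorem contMDiff_fibreInclusion (q : Q) :
    ContMDiff 𝓘(ℝ, Fin k → E) (kModel E k) ∞ (fibreInclusion (E := E) (k := k) q) := by
  intro v
  refine contMDiffAt_totalSpace.2 ⟨contMDiffAt_const, ?_⟩
  have h : (fun v => (trivializationAt (Fin k → E) (KTangentSpace E k : Q → Type _) q
      (fibreInclusion (E := E) q v)).2) =
      (ContinuousLinearMap.piMap fun _ : Fin k => (tangentCoord 𝓘(ℝ, E) q q : E →L[ℝ] E)) :=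
    funext fun v => funext fun a => trivializationAt_kTangent_snd q (mem_chart_source E q) v a
  exact h ▸ (ContinuousLinearMap.contMDiff _).contMDiffAt

/-- Obtained by differentiating the fact that the base part of the chart of `T¹ₖQ` is the chart of
`Q` composed with `π`. -/
theorem fst_tangentCoord {x₀ y : KTangentBundle E Q k}
    (hy : y.proj ∈ (chartAt E x₀.proj).source) (z : TT y) :
    (tangentCoord (kModel E k) x₀ y z).1 =
      tangentCoord 𝓘(ℝ, E) x₀.proj y.proj (dproj y z) := by
  have hy' := (mem_chartAt_source_iff x₀ y).2 hy
  have hd : MDifferentiableAt (kModel E k) 𝓘(ℝ, E × (Fin k → E)) (extChartAt (kModel E k) x₀) y :=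
    mdifferentiableAt_extChartAt hy'
  have hd' : MDifferentiableAt 𝓘(ℝ, E) 𝓘(ℝ, E) (extChartAt 𝓘(ℝ, E) x₀.proj) y.proj :=
    mdifferentiableAt_extChartAt hy
  have hp : MDifferentiableAt (kModel E k) 𝓘(ℝ, E) (proj (E := E) (Q := Q) (k := k)) y :=
    contMDiff_proj_kTangent.contMDiffAt.mdifferentiableAt (by simp)
  have hfst : HasMFDerivAt 𝓘(ℝ, E × (Fin k → E)) 𝓘(ℝ, E) (Prod.fst : E × (Fin k → E) → E)
      (extChartAt (kModel E k) x₀ y) (ContinuousLinearMap.fst ℝ E (Fin k → E)) :=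
    (ContinuousLinearMap.fst ℝ E (Fin k → E)).hasMFDerivAt
  have h₁ := hfst.comp y hd.hasMFDerivAt
  have h₂ := hd'.hasMFDerivAt.comp y hp.hasMFDerivAt
  have hee : (Prod.fst ∘ extChartAt (kModel E k) x₀) =ᶠ[𝓝 y]
      (extChartAt 𝓘(ℝ, E) x₀.proj ∘ proj (E := E) (Q := Q) (k := k)) := by
    filter_upwards [(chartAt (ModelProd E (Fin k → E)) x₀).open_source.mem_nhds hy'] with w hw
    rw [Function.comp_apply, extChartAt_kTangent_apply x₀ w ((mem_chartAt_source_iff x₀ w).1 hw)]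
    rfl
  have h₃ := hasMFDerivAt_unique h₁ (h₂.congr_of_eventuallyEq hee)
  rw [tangentCoord_eq_mfderiv hy', tangentCoord_eq_mfderiv hy]
  exact congrArg (fun f => f z) h₃

/-- In the chart the fibre inclusion is an affine map, with linear part `k` copies of the tangent
coordinates. -/
theorem tangentCoord_verticalLift {x₀ y : KTangentBundle E Q k}
    (hy : y.proj ∈ (chartAt E x₀.proj).source) (a : Fin k)
    (w : TangentSpace 𝓘(ℝ, E) y.proj) :
    tangentCoord (kModel E k) x₀ y (verticalLift a y w) =
      (0, Pi.single a (tangentCoord 𝓘(ℝ, E) x₀.proj y.proj w)) := by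
  have hy' := (mem_chartAt_source_iff x₀ y).2 hy
  let s : Fin k → E := y.snd
  let T : E →L[ℝ] E := tangentCoord 𝓘(ℝ, E) x₀.proj y.proj
  let A : (Fin k → E) →L[ℝ] E × (Fin k → E) := (ContinuousLinearMap.inr ℝ E (Fin k → E)).comp
    (ContinuousLinearMap.piMap fun _ : Fin k => T)
  have hd : MDifferentiableAt (kModel E k) 𝓘(ℝ, E × (Fin k → E)) (extChartAt (kModel E k) x₀)
      (fibreInclusion (E := E) (k := k) y.proj s) :=
    mdifferentiableAt_extChartAt hy'
  have hi : MDifferentiableAt 𝓘(ℝ, Fin k → E) (kModel E k)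
      (fibreInclusion (E := E) (k := k) y.proj) s :=
    (contMDiff_fibreInclusion y.proj).contMDiffAt.mdifferentiableAt (by simp)
  have h₁ := hd.hasMFDerivAt.comp s hi.hasMFDerivAt
  have hA : (extChartAt (kModel E k) x₀ ∘ fibreInclusion (E := E) (k := k) y.proj) =
      fun v => (extChartAt 𝓘(ℝ, E) x₀.proj y.proj, (0 : Fin k → E)) + A v := by
    funext v
    have h := extChartAt_kTangent_apply x₀ (fibreInclusion (E := E) (k := k) y.proj v) hy
    exact h.trans (Prod.ext (add_zero _).symm (zero_add _).symm)
  have h₂ : HasMFDerivAt 𝓘(ℝ, Fin k → E) 𝓘(ℝ, E × (Fin k → E))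
      (extChartAt (kModel E k) x₀ ∘ fibreInclusion (E := E) (k := k) y.proj) s A := by
    rw [hA]
    exact (A.hasFDerivAt.const_add _).hasMFDerivAt
  have h₃ := hasMFDerivAt_unique h₁ h₂
  rw [tangentCoord_eq_mfderiv hy']
  refine (congrArg (fun f : (Fin k → E) →L[ℝ] E × (Fin k → E) =>
    f (Pi.single a (w : E) : Fin k → E)) h₃).trans (Prod.ext rfl (funext fun b => ?_))
  exact Pi.apply_single (fun _ : Fin k => T) (fun _ => map_zero T) a (w : E) b

end Coordinates

/-! ### Vertical endomorphisms, the second order condition and vertical fields -/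

section VerticalStructure

variable {E : Type*} [NormedAddCommGroup E] [NormedSpace ℝ E]
  {Q : Type*} [TopologicalSpace Q] [ChartedSpace E Q] [IsManifold 𝓘(ℝ, E) ∞ Q] {k : ℕ}

/-- `J^α` has constant coefficients in induced coordinates, so it preserves smoothness of vector
fields. -/
theorem tangentCoord_vertEndo {x₀ y : KTangentBundle E Q k}
    (hy : y.proj ∈ (chartAt E x₀.proj).source) (a : Fin k) (z : TT y) :
    tangentCoord (kModel E k) x₀ y (vertEndo a y z) =
      (0, Pi.single a (tangentCoord (kModel E k) x₀ y z).1) := by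
  rw [fst_tangentCoord hy]
  exact tangentCoord_verticalLift hy a (dproj y z)

theorem dproj_eq_zero_iff {x₀ y : KTangentBundle E Q k}
    (hy : y.proj ∈ (chartAt E x₀.proj).source) (z : TT y) :
    dproj y z = 0 ↔ (tangentCoord (kModel E k) x₀ y z).1 = 0 := by
  rw [fst_tangentCoord hy]
  exact ((tangentCoord_injective hy).eq_iff' (map_zero _)).symm

theorem smoothVF_vertEndo {Z : VF E Q k} (hZ : SmoothVF Z) (a : Fin k) :
    SmoothVF fun x => vertEndo a x (Z x) := by
  intro x
  have hx := mem_chart_source (ModelProd E (Fin k → E)) x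
  have h₁ := (contMDiffAt_section_iff_tangentCoord hx).1 (hZ x)
  refine (contMDiffAt_section_iff_tangentCoord hx).2 ?_
  let S : E × (Fin k → E) →L[ℝ] E × (Fin k → E) := (ContinuousLinearMap.inr ℝ E (Fin k → E)).comp
    ((ContinuousLinearMap.single ℝ (fun _ : Fin k => E) a).comp
      (ContinuousLinearMap.fst ℝ E (Fin k → E)))
  refine (S.contMDiff.contMDiffAt.comp x h₁).congr_of_eventuallyEq ?_
  filter_upwards [chart_source_mem_nhds (ModelProd E (Fin k → E)) x] with y hy
  exact tangentCoord_vertEndo ((mem_chartAt_source_iff x y).1 hy) a (Z y)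

/-- The second order condition: `∑_α J^α(u_α) = Δ` at `x = (q; v)` means `Tπ(u_α) = v_α`. -/
theorem sum_vertEndo_eq_liouville_iff (x : KTangentBundle E Q k) (u : Fin k → TT x) :
    ∑ a, vertEndo a x (u a) = liouville x ↔ ∀ a, dproj x (u a) = x.snd a := by
  have hx := mem_chart_source E x.proj
  -- Lifts with different `α` occupy different slots of the fibre coordinates, so the sum determines
  -- each summand.
  have h : ∀ w : Fin k → E, tangentCoord (kModel E k) x x (∑ a, verticalLift a x (w a)) =
      (0, fun a => tangentCoord 𝓘(ℝ, E) x.proj x.proj (w a)) := by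
    intro w
    rw [map_sum]
    refine (Finset.sum_congr rfl fun a _ => tangentCoord_verticalLift hx a (w a)).trans ?_
    refine Prod.ext ?_ (funext fun b => ?_)
    · rw [Prod.fst_sum]
      exact Finset.sum_const_zero
    · rw [Prod.snd_sum, Finset.sum_apply]
      exact (Finset.sum_pi_single b _ _).trans (if_pos (Finset.mem_univ b))
  have h₁ : tangentCoord (kModel E k) x x (∑ a, vertEndo a x (u a)) =
      (0, fun a => tangentCoord 𝓘(ℝ, E) x.proj x.proj (dproj x (u a))) := h _
  have h₂ : tangentCoord (kModel E k) x x (liouville x) =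
      (0, fun a => tangentCoord 𝓘(ℝ, E) x.proj x.proj (x.snd a)) := h _
  constructor
  · intro e a
    rw [e, h₂] at h₁
    exact (tangentCoord_injective hx (congrFun (congrArg Prod.snd h₁) a)).symm
  · intro e
    exact Finset.sum_congr rfl fun a _ => congrArg (verticalLift a x) (e a)

/-! ### Linearity of `Ω_L` -/

/-- `Ω_L` at a point, as a linear map. -/
def omegaLin (L : KTangentBundle E Q k → ℝ) (x : KTangentBundle E Q k) :
    (Fin k → TT x) →ₗ[ℝ] TT x →L[ℝ] ℝ :=
  ∑ a, (cartanTwoForm L a x).toLinearMap ∘ₗ LinearMap.proj a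

theorem omegaLin_apply (L : KTangentBundle E Q k → ℝ) (x : KTangentBundle E Q k)
    (X : Fin k → TT x) : omegaLin L x X = Omega L x X := by
  simp [omegaLin, Omega]

/-- The vertical `k`-tuples of tangent vectors at `x`. -/
def verticalSubmodule (x : KTangentBundle E Q k) : Submodule ℝ (Fin k → TT x) where
  carrier := {v | IsVerticalAt x v}
  add_mem' {v w} hv hw a := by
    rw [Pi.add_apply, map_add, hv a, hw a, add_zero]
  zero_mem' _ := map_zero _
  smul_mem' c v hv a := by
    rw [Pi.smul_apply, map_smul, hv a, smul_zero]

variable [FiniteDimensional ℝ E]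

/-! ### Vertical vector fields -/

theorem dproj_coordField (x₀ y : KTangentBundle E Q k) (w : Fin k → E) :
    dproj y (coordField (kModel E k) x₀ y (0, w)) = 0 := by
  by_cases hy : y ∈ (chartAt (ModelProd E (Fin k → E)) x₀).source
  · rw [dproj_eq_zero_iff ((mem_chartAt_source_iff x₀ y).1 hy), tangentCoord_coordField hy]
    exact smul_zero _
  · rw [coordField_eq_zero hy, map_zero]

/-- The vertical `k`-vector field with given coordinates in the chart at `x₀`. -/
def verticalCoordField (x₀ : KTangentBundle E Q k) (w : Fin k → Fin k → E) : KVF E Q k :=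
  fun y a => coordField (kModel E k) x₀ y (0, w a)

/-- Vertical vectors are those with zero base coordinate. The neighbourhood serves all vertical
tuples at once, as is needed to describe `𝔐_y` for all `y` near `x₀` by one linear system. -/
theorem eventually_verticalCoordField (x₀ : KTangentBundle E Q k) :
    ∀ᶠ y in 𝓝 x₀, ∀ v : Fin k → TT y, IsVerticalAt y v →
      ∃ w, verticalCoordField x₀ w y = v := by
  filter_upwards [eventually_coordField (kModel E k) x₀] with y hy v hv
  refine ⟨fun a => (tangentCoord (kModel E k) x₀ y (v a)).2, funext fun a => ?_⟩
  have h := (dproj_eq_zero_iff ((mem_chartAt_source_iff x₀ y).1 hy.1) (v a)).1 (hv a)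
  refine Eq.trans ?_ (hy.2.2 (v a))
  exact congrArg (coordField (kModel E k) x₀ y) (Prod.ext h.symm rfl)

variable [T2Space Q]

theorem contMDiff_cartanTwoForm_apply {L : KTangentBundle E Q k → ℝ}
    (hL : ContMDiff (kModel E k) 𝓘(ℝ, ℝ) ∞ L) (a : Fin k) {A B : VF E Q k}
    (hA : SmoothVF A) (hB : SmoothVF B) :
    ContMDiff (kModel E k) 𝓘(ℝ, ℝ) ∞ fun x => cartanTwoForm L a x (A x) (B x) :=
  (contMDiff_extDerivOneForm (θ := cartanOneForm L a)
    (fun _ hZ => contMDiff_mfderiv_apply hL (smoothVF_vertEndo hZ a)) hA hB).neg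

theorem contMDiff_Omega_apply {L : KTangentBundle E Q k → ℝ}
    (hL : ContMDiff (kModel E k) 𝓘(ℝ, ℝ) ∞ L) {X : KVF E Q k} {Z : VF E Q k}
    (hX : SmoothKVF X) (hZ : SmoothVF Z) :
    ContMDiff (kModel E k) 𝓘(ℝ, ℝ) ∞ fun x => Omega L x (X x) (Z x) := by
  have h : (fun x => Omega L x (X x) (Z x)) =
      fun x => ∑ a, cartanTwoForm L a x (X x a) (Z x) := by
    funext x
    simp [Omega]
  rw [h]
  exact contMDiff_finsetSum fun a _ => contMDiff_cartanTwoForm_apply hL a (hX a) hZ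

theorem verticalCoordField_mem (x₀ : KTangentBundle E Q k) (w : Fin k → Fin k → E) :
    verticalCoordField x₀ w ∈ verticalKVF E Q k :=
  ⟨fun a => contMDiff_coordField x₀ ((0 : E), w a), fun y a => dproj_coordField x₀ y (w a)⟩

/-- This makes testing against vertical fields equivalent to testing against vertical tuples at each
point. -/
theorem exists_verticalKVF_eq {x : KTangentBundle E Q k} {v : Fin k → TT x}
    (hv : IsVerticalAt x v) : ∃ V ∈ verticalKVF E Q k, V x = v := by
  obtain ⟨w, hw⟩ := (eventually_verticalCoordField x).self_of_nhds v hv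
  exact ⟨_, verticalCoordField_mem x w, hw⟩

end VerticalStructure

/-! ### The constraint set `S₁` -/

section Pointwise

variable {E : Type*} [NormedAddCommGroup E] [NormedSpace ℝ E]
  {Q : Type*} [TopologicalSpace Q] [ChartedSpace E Q] [IsManifold 𝓘(ℝ, E) ∞ Q] {k : ℕ}
  {L : KTangentBundle E Q k → ℝ} {X Y : KVF E Q k}

theorem Omega_add (x : KTangentBundle E Q k) (u v : Fin k → TT x) :
    Omega L x (u + v) = Omega L x u + Omega L x v := by
  simp only [← omegaLin_apply, map_add]

theorem Omega_sub (x : KTangentBundle E Q k) (u v : Fin k → TT x) :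
    Omega L x (u - v) = Omega L x u - Omega L x v := by
  simp only [← omegaLin_apply, map_sub]

theorem isVerticalAt_sub_of_secondOrder {x : KTangentBundle E Q k} {u v : Fin k → TT x}
    (hu : ∀ a, dproj x (u a) = x.snd a) (hv : ∀ a, dproj x (v a) = x.snd a) :
    IsVerticalAt x (u - v) := fun a => by
  rw [Pi.sub_apply, map_sub, hu a, hv a, sub_self]

/-- Second order tuples differ by vertical ones and `X + Y` is second order, so the admissible
corrections are `Y + v` with `v` vertical; lying in the kernel of `Ω` then reads `Ω(v) = -Ω(Y)`. -/
theorem mem_S1_iff (hXY : IsSopde (X + Y)) {x : KTangentBundle E Q k} :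
    x ∈ S1 L X ↔ x ∈ P1 L ∧ ∃ v : Fin k → TT x, IsVerticalAt x v ∧
      Omega L x v = - Omega L x (Y x) := by
  refine and_congr_right fun _ => ⟨?_, ?_⟩
  · rintro ⟨y, hy, h⟩
    rw [sum_vertEndo_eq_liouville_iff] at h
    refine ⟨y - Y x, ?_, by rw [Omega_sub, hy, zero_sub]⟩
    have := isVerticalAt_sub_of_secondOrder (u := X x + y) (v := X x + Y x) h (hXY x)
    rwa [add_sub_add_left_eq_sub] at this
  · rintro ⟨v, hv, h⟩
    refine ⟨Y x + v, by rw [Omega_add, h, add_neg_cancel], ?_⟩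
    rw [sum_vertEndo_eq_liouville_iff]
    intro a
    have h₁ : dproj x (X x a + Y x a) = x.snd a := hXY x a
    rw [Pi.add_apply, ← add_assoc, map_add, h₁, hv a, add_zero]

theorem mem_S1_of_sopde (hXL : ∀ x ∈ P1 L, LagrangianEqAt L x (X x)) {Γ : KVF E Q k}
    (hΓ : IsSopde Γ) {x : KTangentBundle E Q k} (hx : x ∈ P1 L)
    (hΓL : LagrangianEqAt L x (Γ x)) : x ∈ S1 L X := by
  refine ⟨hx, Γ x - X x, ?_, ?_⟩
  · rw [Omega_sub, hΓL, hXL x hx, sub_self]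
  · rw [sum_vertEndo_eq_liouville_iff]
    intro a
    rw [Pi.sub_apply, add_sub_cancel]
    exact hΓ x a

theorem smoothKVF_add {X Y : KVF E Q k} (hX : SmoothKVF X) (hY : SmoothKVF Y) :
    SmoothKVF (X + Y) := fun a => (hX a).add_section (hY a)

theorem smoothKVF_sub {X Y : KVF E Q k} (hX : SmoothKVF X) (hY : SmoothKVF Y) :
    SmoothKVF (X - Y) := fun a => (hX a).sub_section (hY a)

/-- A vector field that is smooth on an open set can be cut off. -/
theorem smoothVF_smul_of_tsupport {Z : VF E Q k} {O : Set (KTangentBundle E Q k)}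
    (hO : IsOpen O) (hZ : ∀ y ∈ O, ContMDiffAt (kModel E k) (kModel E k).tangent ∞
      (fun x => (⟨x, Z x⟩ : TangentBundle (kModel E k) (KTangentBundle E Q k))) y)
    {f : KTangentBundle E Q k → ℝ} (hf : ContMDiff (kModel E k) 𝓘(ℝ, ℝ) ∞ f)
    (hfO : tsupport f ⊆ O) : SmoothVF fun y => f y • Z y :=
  ContMDiffOn.smul_section_of_tsupport hf.contMDiffOn hO hfO
    fun y hy => (hZ y hy).contMDiffWithinAt

theorem isSopde_add_vertical {Γ V : KVF E Q k} (hΓ : IsSopde Γ)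
    (hV : ∀ x, IsVerticalAt x (V x)) : IsSopde (Γ + V) := fun x a => by
  rw [Pi.add_apply, Pi.add_apply, map_add, hΓ x a, hV x a, add_zero]

theorem lagrangianEqAt_add {x : KTangentBundle E Q k} {u y v : Fin k → TT x}
    (hu : LagrangianEqAt L x u) (hv : Omega L x v = - Omega L x y) :
    LagrangianEqAt L x (u + y + v) := by
  rw [LagrangianEqAt, Omega_add, Omega_add, hv, hu, add_neg_cancel_right]

/-- The difference of the two SOPDEs is a vertical field, hence annihilated by `𝔐`. On `P1` the
images of `X` and `X'` under `Ω` are both the differential of the energy, so what remains is `Ω(Y')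
- Ω(Y)`. -/
theorem fieldConstraintSet_eq {X' Y' : KVF E Q k} (hX : SmoothKVF X) (hY : SmoothKVF Y)
    (hXL : ∀ x ∈ P1 L, LagrangianEqAt L x (X x)) (hXY : IsSopde (X + Y))
    (hX' : SmoothKVF X') (hY' : SmoothKVF Y')
    (hXL' : ∀ x ∈ P1 L, LagrangianEqAt L x (X' x)) (hXY' : IsSopde (X' + Y')) :
    fieldConstraintSet L Y' = fieldConstraintSet L Y := by
  have hV : X' + Y' - (X + Y) ∈ verticalKVF E Q k :=
    ⟨smoothKVF_sub (smoothKVF_add hX' hY') (smoothKVF_add hX hY),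
      fun x => isVerticalAt_sub_of_secondOrder (hXY' x) (hXY x)⟩
  ext x
  refine and_congr_right fun hx => forall₂_congr fun Z hZ => ?_
  have h₁ : Omega L x (X' x + Y' x - (X x + Y x)) (Z x) = 0 := hZ.2 _ hV x
  have h₂ : Omega L x (X' x + Y' x - (X x + Y x)) = Omega L x (Y' x) - Omega L x (Y x) := by
    rw [Omega_sub, Omega_add, Omega_add, hXL x hx, hXL' x hx, add_sub_add_left_eq_sub]
  rw [h₂, sub_apply, sub_eq_zero] at h₁
  rw [h₁]

variable [FiniteDimensional ℝ E]

/-- A Fredholm alternative: the image `W` of the vertical tuples under `Ω` is a subspace of a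
finite-dimensional dual, so it is the annihilator of its coannihilator, and the latter is `𝔐ₓ`. -/
theorem S1_eq_constraintSet (hXY : IsSopde (X + Y)) : S1 L X = constraintSet L Y := by
  ext x
  rw [mem_S1_iff hXY]
  refine and_congr_right fun _ => ⟨?_, fun h => ?_⟩
  · rintro ⟨v, hv, h⟩ z hz
    have := congrArg (fun f : TT x →L[ℝ] ℝ => f z) h
    simp only [neg_apply, hz v hv] at this
    exact neg_eq_zero.1 this.symm
  · have : FiniteDimensional ℝ (TT x) := inferInstanceAs (FiniteDimensional ℝ (E × (Fin k → E)))
    let W : Submodule ℝ (Module.Dual ℝ (TT x)) := (verticalSubmodule x).map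
      ((ContinuousLinearMap.coeLM ℝ : (TT x →L[ℝ] ℝ) →ₗ[ℝ] TT x →ₗ[ℝ] ℝ) ∘ₗ omegaLin L x)
    have hW : ((Omega L x (Y x) : TT x →L[ℝ] ℝ) : TT x →ₗ[ℝ] ℝ) ∈ W := by
      rw [← Subspace.dualCoannihilator_dualAnnihilator_eq (W := W), Submodule.mem_dualAnnihilator]
      intro z hz
      rw [Submodule.mem_dualCoannihilator] at hz
      refine h z fun v hv => ?_
      rw [← omegaLin_apply]
      exact hz _ ⟨v, hv, rfl⟩
    obtain ⟨v, hv, h⟩ := hW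
    refine ⟨-v, (verticalSubmodule x).neg_mem hv, ?_⟩
    have h' : omegaLin L x v = Omega L x (Y x) := ContinuousLinearMap.coe_injective h
    rw [← omegaLin_apply, map_neg, h']

variable [T2Space Q]

theorem isGreatest_S1 (hX : SmoothKVF X) (hY : SmoothKVF Y)
    (hXL : ∀ x ∈ P1 L, LagrangianEqAt L x (X x)) (hXY : IsSopde (X + Y)) :
    IsGreatest {S | S ⊆ P1 L ∧ ∀ x ∈ S, ∃ Γ : KVF E Q k,
      SmoothKVF Γ ∧ IsSopde Γ ∧ LagrangianEqAt L x (Γ x)} (S1 L X) := by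
  refine ⟨⟨fun x hx => hx.1, fun x hx => ?_⟩, ?_⟩
  · obtain ⟨v, hv, h⟩ := ((mem_S1_iff hXY).1 hx).2
    obtain ⟨V, hV, rfl⟩ := exists_verticalKVF_eq hv
    exact ⟨X + Y + V, smoothKVF_add (smoothKVF_add hX hY) hV.1,
      isSopde_add_vertical hXY hV.2, lagrangianEqAt_add (hXL x hx.1) h⟩
  · rintro S ⟨hSP, hS⟩ x hx
    obtain ⟨Γ, -, hΓ, hΓL⟩ := hS x hx
    exact mem_S1_of_sopde hXL hΓ (hSP hx) hΓL

theorem frakM_apply_mem {Z : VF E Q k} (hZ : Z ∈ frakM L) (x : KTangentBundle E Q k) :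
    Z x ∈ frakMAt L x := fun v hv => by
  obtain ⟨V, hV, rfl⟩ := exists_verticalKVF_eq hv
  exact hZ.2 V hV x

theorem constraintSet_subset_fieldConstraintSet :
    constraintSet L Y ⊆ fieldConstraintSet L Y :=
  fun x hx => ⟨hx.1, fun Z hZ => hx.2 (Z x) (frakM_apply_mem hZ x)⟩

end Pointwise

/-! ### Consequences of `dim 𝔐ₓ` being locally constant -/

section ConstantRankConstraint

variable {E : Type*} [NormedAddCommGroup E] [NormedSpace ℝ E] [FiniteDimensional ℝ E]
  {Q : Type*} [TopologicalSpace Q] [ChartedSpace E Q] [IsManifold 𝓘(ℝ, E) ∞ Q] {k : ℕ}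
  {L : KTangentBundle E Q k → ℝ}

/-- `verticalCoordField` at a point, as a linear map. -/
def verticalCoordLin (x₀ y : KTangentBundle E Q k) :
    (Fin k → Fin k → E) →ₗ[ℝ] Fin k → TT y :=
  LinearMap.pi fun a => (coordField (kModel E k) x₀ y).toLinearMap ∘ₗ
    LinearMap.inr ℝ E (Fin k → E) ∘ₗ LinearMap.proj a

theorem verticalCoordLin_apply (x₀ y : KTangentBundle E Q k) (w : Fin k → Fin k → E) :
    verticalCoordLin x₀ y w = verticalCoordField x₀ w y := rfl

variable (E k) in
/-- The coordinates of the vertical `k`-tuples in a basis. -/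
abbrev VerticalIndex : Type := Fin (Module.finrank ℝ (Fin k → Fin k → E))

variable (E k) in
/-- A basis of the coordinate space of the vertical `k`-tuples. -/
def verticalBasis : Module.Basis (VerticalIndex E k) ℝ (Fin k → Fin k → E) :=
  Module.finBasis ℝ _

/-- The linear system that defines `𝔐_y`, in the coordinates around `x₀`. -/
def constraintMap (L : KTangentBundle E Q k → ℝ) (x₀ y : KTangentBundle E Q k) :
    E × (Fin k → E) →L[ℝ] VerticalIndex E k → ℝ :=
  ContinuousLinearMap.pi fun i =>
    (Omega L y (verticalCoordField x₀ (verticalBasis E k i) y)).comp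
      (coordField (kModel E k) x₀ y)

theorem constraintMap_apply (x₀ y : KTangentBundle E Q k) (v : E × (Fin k → E))
    (i : VerticalIndex E k) :
    constraintMap L x₀ y v i = Omega L y (verticalCoordField x₀ (verticalBasis E k i) y)
      (coordField (kModel E k) x₀ y v) := rfl

/-- Near `x₀` the vertical tuples are linear combinations of the coordinate ones, so by linearity a
basis suffices as test family. -/
theorem eventually_constraintMap_eq_zero_iff (x₀ : KTangentBundle E Q k) :
    ∀ᶠ y in 𝓝 x₀, ∀ v, constraintMap L x₀ y v = 0 ↔
      coordField (kModel E k) x₀ y v ∈ frakMAt L y := by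
  filter_upwards [eventually_verticalCoordField x₀] with y hy v
  refine ⟨fun h u hu => ?_, fun h => funext fun i =>
    h _ fun a => dproj_coordField x₀ y (verticalBasis E k i a)⟩
  obtain ⟨w, rfl⟩ := hy u hu
  let ev : (TT y →L[ℝ] ℝ) →ₗ[ℝ] ℝ :=
    { toFun := fun f => f (coordField (kModel E k) x₀ y v)
      map_add' := fun _ _ => rfl
      map_smul' := fun _ _ => rfl }
  have h₁ : ev ∘ₗ omegaLin L y ∘ₗ verticalCoordLin x₀ y = 0 := by
    refine (verticalBasis E k).ext fun i => ?_
    have := congrFun h i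
    rw [constraintMap_apply, ← omegaLin_apply] at this
    exact this
  have h₂ := LinearMap.congr_fun h₁ w
  rw [← omegaLin_apply]
  exact h₂

/-- Near `x₀` the coordinate fields give an isomorphism from the model space that carries the kernel
onto `𝔐_y`; constancy of `dim 𝔐_y` thus becomes constant nullity. -/
theorem eventually_finrank_ker_constraintMap (x₀ : KTangentBundle E Q k) :
    ∀ᶠ y in 𝓝 x₀, Module.finrank ℝ (LinearMap.ker (constraintMap L x₀ y).toLinearMap) =
      Module.finrank ℝ (frakMAt L y) := by
  filter_upwards [eventually_constraintMap_eq_zero_iff x₀,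
    eventually_coordField (kModel E k) x₀] with y h₁ h₂
  let e : (E × (Fin k → E)) ≃ₗ[ℝ] TT y := LinearEquiv.ofLinearMap
    (coordField (kModel E k) x₀ y).toLinearMap (tangentCoord (kModel E k) x₀ y).toLinearMap
    (LinearMap.ext h₂.2.2) (LinearMap.ext h₂.2.1)
  have h : (LinearMap.ker (constraintMap L x₀ y).toLinearMap).map e.toLinearMap =
      frakMAt L y := by
    ext z
    constructor
    · rintro ⟨v, hv, rfl⟩
      exact (h₁ v).1 hv
    · intro hz
      refine ⟨tangentCoord (kModel E k) x₀ y z, (h₁ _).2 ?_, h₂.2.2 z⟩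
      rwa [h₂.2.2 z]
  rw [← h, LinearEquiv.finrank_map_eq]

variable [T2Space Q]

theorem contMDiff_constraintMap (hL : ContMDiff (kModel E k) 𝓘(ℝ, ℝ) ∞ L)
    (x₀ : KTangentBundle E Q k) :
    ContMDiff (kModel E k) 𝓘(ℝ, E × (Fin k → E) →L[ℝ] VerticalIndex E k → ℝ) ∞
      (constraintMap L x₀) := by
  intro y
  refine contMDiffAt_of_clm_apply fun v => contMDiffAt_pi_space.2 fun i => ?_
  exact (contMDiff_Omega_apply hL (verticalCoordField_mem x₀ (verticalBasis E k i)).1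
    (contMDiff_coordField x₀ v)).contMDiffAt

/-- If `dim 𝔐_y` is constant near `x₀`, the linear system defining `𝔐_y` has a smooth
generalized inverse near `x₀`. -/
theorem exists_generalizedInverse_constraintMap (hL : ContMDiff (kModel E k) 𝓘(ℝ, ℝ) ∞ L)
    {x₀ : KTangentBundle E Q k}
    (hrank : ∀ᶠ y in 𝓝 x₀,
      Module.finrank ℝ (frakMAt L y) = Module.finrank ℝ (frakMAt L x₀)) :
    ∃ (P : KTangentBundle E Q k → (VerticalIndex E k → ℝ) →L[ℝ] E × (Fin k → E))
      (O : Set (KTangentBundle E Q k)), IsOpen O ∧ x₀ ∈ O ∧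
      ContMDiffOn (kModel E k) 𝓘(ℝ, (VerticalIndex E k → ℝ) →L[ℝ] E × (Fin k → E)) ∞ P O ∧
      ∀ y ∈ O, (∀ v, constraintMap L x₀ y (P y (constraintMap L x₀ y v)) =
          constraintMap L x₀ y v) ∧
        (∀ v, constraintMap L x₀ y v = 0 ↔ coordField (kModel E k) x₀ y v ∈ frakMAt L y) ∧
        ∀ z, coordField (kModel E k) x₀ y (tangentCoord (kModel E k) x₀ y z) = z := by
  have hk := eventually_finrank_ker_constraintMap (L := L) x₀
  obtain ⟨P, O, hO, hx, hP, hB⟩ := exists_smooth_generalizedInverse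
    (contMDiff_constraintMap hL x₀) (x₀ := x₀) (by
      filter_upwards [hrank, hk] with y h₁ h₂
      rw [h₂, h₁, hk.self_of_nhds])
  obtain ⟨O', hO', hO'o, hx'⟩ := eventually_nhds_iff.1
    ((eventually_constraintMap_eq_zero_iff (L := L) x₀).and
      (eventually_coordField (kModel E k) x₀))
  exact ⟨P, O ∩ O', hO.inter hO'o, ⟨hx, hx'⟩, hP.mono inter_subset_left,
    fun y hy => ⟨hB y hy.1, (hO' y hy.2).1, (hO' y hy.2).2.2.2⟩⟩

theorem exists_bump {O : Set (KTangentBundle E Q k)} (hO : IsOpen O) {x₀ : KTangentBundle E Q k}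
    (hx₀ : x₀ ∈ O) : ∃ f : KTangentBundle E Q k → ℝ, ContMDiff (kModel E k) 𝓘(ℝ, ℝ) ∞ f ∧
      tsupport f ⊆ O ∧ ∀ᶠ y in 𝓝 x₀, f y = 1 := by
  obtain ⟨f, -, hf⟩ := (SmoothBumpFunction.nhds_basis_tsupport (I := kModel E k) x₀).mem_iff.1
    (hO.mem_nhds hx₀)
  exact ⟨f, f.contMDiff, hf, f.eventuallyEq_one⟩

/-- If `dim 𝔐_y` is constant near `x₀`, every element of `𝔐` at `x₀` extends to a vector field
in `𝔐`. -/
theorem exists_frakM_extension (hL : ContMDiff (kModel E k) 𝓘(ℝ, ℝ) ∞ L)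
    {x₀ : KTangentBundle E Q k}
    (hrank : ∀ᶠ y in 𝓝 x₀,
      Module.finrank ℝ (frakMAt L y) = Module.finrank ℝ (frakMAt L x₀))
    {z : TT x₀} (hz : z ∈ frakMAt L x₀) : ∃ Z ∈ frakM L, Z x₀ = z := by
  obtain ⟨P, O, hO, hx₀, hP, h⟩ := exists_generalizedInverse_constraintMap hL hrank
  obtain ⟨f, hf, hfO, hf₁⟩ := exists_bump hO hx₀
  let v := tangentCoord (kModel E k) x₀ x₀ z
  -- With `B = constraintMap L x₀`, the identity `B P B = B` puts `v - P B v` in the kernel of `B`,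
  -- and at `x₀` the correction is zero because `B v = 0` there.
  let u : KTangentBundle E Q k → E × (Fin k → E) := fun y => v - P y (constraintMap L x₀ y v)
  have hu : ∀ y ∈ O, ContMDiffAt (kModel E k) 𝓘(ℝ, E × (Fin k → E)) ∞ u y := fun y hy =>
    contMDiffAt_const.sub ((hP.contMDiffAt (hO.mem_nhds hy)).clm_apply
      ((contMDiff_constraintMap hL x₀).contMDiffAt.clm_apply contMDiffAt_const))
  have hmem : ∀ y ∈ O, coordField (kModel E k) x₀ y (u y) ∈ frakMAt L y := fun y hy => by
    rw [← (h y hy).2.1, map_sub, (h y hy).1, sub_self]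
  refine ⟨fun y => f y • coordField (kModel E k) x₀ y (u y), ⟨smoothVF_smul_of_tsupport hO
    (fun y hy => contMDiffAt_coordField x₀ (hu y hy)) hf hfO, fun V hV y => ?_⟩, ?_⟩
  · by_cases hy : y ∈ O
    · exact (frakMAt L y).smul_mem (f y) (hmem y hy) _ (hV.2 y)
    · have : f y = 0 := image_eq_zero_of_notMem_tsupport fun h => hy (hfO h)
      simp [this]
  · have hv : constraintMap L x₀ x₀ v = 0 := by
      rw [(h x₀ hx₀).2.1, (h x₀ hx₀).2.2]
      exact hz
    simp only [u, hv, map_zero, sub_zero, hf₁.self_of_nhds, one_smul]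
    exact (h x₀ hx₀).2.2 z

/-- If `dim 𝔐_y` is constant near `x₀`, the equation `Ω_L(V) = -Ω_L(Y)` has a smooth vertical
solution on the set of points near `x₀` where it is solvable. -/
theorem exists_local_vertical_solution (hL : ContMDiff (kModel E k) 𝓘(ℝ, ℝ) ∞ L)
    {Y : KVF E Q k} (hY : SmoothKVF Y) {x₀ : KTangentBundle E Q k}
    (hrank : ∀ᶠ y in 𝓝 x₀,
      Module.finrank ℝ (frakMAt L y) = Module.finrank ℝ (frakMAt L x₀)) :
    ∃ V ∈ verticalKVF E Q k, ∃ O : Set (KTangentBundle E Q k), IsOpen O ∧ x₀ ∈ O ∧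
      ∀ y ∈ O, (∀ z ∈ frakMAt L y, Omega L y (Y y) z = 0) →
        Omega L y (V y) = - Omega L y (Y y) := by
  obtain ⟨P, O, hO, hx₀, hP, h⟩ := exists_generalizedInverse_constraintMap hL hrank
  obtain ⟨f, hf, hfO, hf₁⟩ := exists_bump hO hx₀
  let lam : KTangentBundle E Q k → E × (Fin k → E) →L[ℝ] ℝ := fun y =>
    (Omega L y (Y y)).comp (coordField (kModel E k) x₀ y)
  have hlam : ContMDiff (kModel E k) 𝓘(ℝ, E × (Fin k → E) →L[ℝ] ℝ) ∞ lam := fun y =>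
    contMDiffAt_of_clm_apply fun v =>
      (contMDiff_Omega_apply hL hY (contMDiff_coordField x₀ v)).contMDiffAt
  -- Where `Ω(Y)` kills `𝔐_y`, its coordinate form `lam` kills every `v - P B v`, so `lam = (lam P)
  -- B`. Thus `lam` combines the rows of `B` with coefficients `lam (P eᵢ)`; the opposite sign
  -- solves the equation, and `c` is smooth on `O` whether or not it is solvable.
  let c : VerticalIndex E k → KTangentBundle E Q k → ℝ := fun i y =>
    - lam y (P y (Pi.single i 1))
  have hc : ∀ i, ∀ y ∈ O, ContMDiffAt (kModel E k) 𝓘(ℝ, ℝ) ∞ (c i) y := fun i y hy =>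
    (hlam.contMDiffAt.clm_apply
      ((hP.contMDiffAt (hO.mem_nhds hy)).clm_apply contMDiffAt_const)).neg
  let w : KTangentBundle E Q k → Fin k → Fin k → E := fun y =>
    ∑ i, c i y • verticalBasis E k i
  have hw : ∀ y ∈ O, ∀ a, ContMDiffAt (kModel E k) 𝓘(ℝ, E × (Fin k → E)) ∞
      (fun y => ((0 : E), w y a)) y := fun y hy a => by
    have h₁ : ContMDiffAt (kModel E k) 𝓘(ℝ, Fin k → Fin k → E) ∞ w y :=
      contMDiffAt_finsetSum fun i _ => (hc i y hy).smul contMDiffAt_const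
    exact contMDiffAt_const.prodMk_space (contMDiffAt_pi_space.1 h₁ a)
  obtain ⟨O', hO', hO'o, hx'⟩ := eventually_nhds_iff.1 hf₁
  refine ⟨fun y a => f y • coordField (kModel E k) x₀ y (0, w y a), ⟨fun a =>
    smoothVF_smul_of_tsupport hO (fun y hy => contMDiffAt_coordField x₀ (hw y hy a)) hf hfO,
    fun y a => by rw [map_smul, dproj_coordField, smul_zero]⟩, O ∩ O', hO.inter hO'o,
    ⟨hx₀, hx'⟩, fun y hy hYz => ?_⟩
  have hV : (fun a => f y • coordField (kModel E k) x₀ y (0, w y a)) =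
      verticalCoordLin x₀ y (w y) := by
    funext a
    rw [hO' y hy.2, one_smul]
    rfl
  refine (congrArg (Omega L y) hV).trans ?_
  rw [← omegaLin_apply]
  refine ContinuousLinearMap.ext fun z => ?_
  obtain ⟨v, rfl⟩ : ∃ v, coordField (kModel E k) x₀ y v = z := ⟨_, (h y hy.1).2.2 z⟩
  have h₁ : omegaLin L y (verticalCoordLin x₀ y (w y)) (coordField (kModel E k) x₀ y v) =
      ∑ i, c i y * constraintMap L x₀ y v i := by
    simp only [w, map_sum, map_smul, sum_apply, smul_apply, smul_eq_mul]
    refine Finset.sum_congr rfl fun i _ => ?_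
    rw [omegaLin_apply, constraintMap_apply, verticalCoordLin_apply]
  have h₂ : lam y (P y (constraintMap L x₀ y v)) =
      ∑ i, constraintMap L x₀ y v i * lam y (P y (Pi.single i 1)) := by
    conv_lhs => rw [pi_eq_sum_univ' (constraintMap L x₀ y v)]
    simp only [map_sum, map_smul, smul_eq_mul]
  have h₃ : lam y (v - P y (constraintMap L x₀ y v)) = 0 := by
    refine hYz _ (((h y hy.1).2.1 _).1 ?_)
    rw [map_sub, (h y hy.1).1, sub_self]
  have h₄ : (- Omega L y (Y y)) (coordField (kModel E k) x₀ y v) = - lam y v := rfl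
  rw [h₁, h₄]
  rw [map_sub, sub_eq_zero, h₂] at h₃
  rw [h₃, ← Finset.sum_neg_distrib]
  exact Finset.sum_congr rfl fun i _ => by simp only [c]; ring

end ConstantRankConstraint

/-! ### A single SOPDE that solves the Lagrangian equation on `S₁` -/

section GlobalSolution

variable {E : Type*} [NormedAddCommGroup E] [NormedSpace ℝ E] [FiniteDimensional ℝ E]
  {Q : Type*} [TopologicalSpace Q] [T2Space Q]
  [ChartedSpace E Q] [IsManifold 𝓘(ℝ, E) ∞ Q] {k : ℕ}
  {L : KTangentBundle E Q k → ℝ} {X Y : KVF E Q k}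

theorem constraintSet_eq_fieldConstraintSet (hL : ContMDiff (kModel E k) 𝓘(ℝ, ℝ) ∞ L)
    (hrank : ∀ x ∈ P1 L, ∀ᶠ y in 𝓝 x,
      Module.finrank ℝ (frakMAt L y) = Module.finrank ℝ (frakMAt L x)) :
    constraintSet L Y = fieldConstraintSet L Y := by
  refine constraintSet_subset_fieldConstraintSet.antisymm fun x hx => ⟨hx.1, fun z hz => ?_⟩
  obtain ⟨Z, hZ, rfl⟩ := exists_frakM_extension hL (hrank x hx.1) hz
  exact hx.2 Z hZ

/-- Beyond `P1`, the set is cut out by zeros of continuous functions. Closedness is what gluing by a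
partition of unity requires. -/
theorem isClosed_fieldConstraintSet (hL : ContMDiff (kModel E k) 𝓘(ℝ, ℝ) ∞ L)
    (hY : SmoothKVF Y) (hP : IsClosed (P1 L)) : IsClosed (fieldConstraintSet L Y) := by
  have h : fieldConstraintSet L Y =
      P1 L ∩ ⋂ Z ∈ frakM L, {x | Omega L x (Y x) (Z x) = 0} := by
    ext x
    simp [fieldConstraintSet]
  rw [h]
  exact hP.inter (isClosed_biInter fun Z hZ =>
    isClosed_eq (contMDiff_Omega_apply hL hY hZ.1).continuous continuous_const)

/-- Local vertical solutions of `Ω_L(V) = -Ω_L(Y)` on a closed set can be glued. -/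
theorem exists_global_vertical_solution [SecondCountableTopology Q]
    {C : Set (KTangentBundle E Q k)} (hC : IsClosed C)
    (hloc : ∀ x ∈ C, ∃ V ∈ verticalKVF E Q k, ∃ O : Set (KTangentBundle E Q k),
      IsOpen O ∧ x ∈ O ∧ ∀ y ∈ O ∩ C, Omega L y (V y) = - Omega L y (Y y)) :
    ∃ V ∈ verticalKVF E Q k, ∀ y ∈ C, Omega L y (V y) = - Omega L y (Y y) := by
  have : SigmaCompactSpace (KTangentBundle E Q k) := sigmaCompactSpace_kTangentBundle
  choose! V hV O hO hxO hVO using hloc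
  obtain ⟨ρ, hρ⟩ := SmoothPartitionOfUnity.exists_isSubordinate (kModel E k) hC
    (fun i : C => O i) (fun i => hO i i.2)
    (fun x hx => mem_iUnion.2 ⟨⟨x, hx⟩, hxO x hx⟩)
  have hfin : ∀ y, (Function.support fun i => ρ i y).Finite := fun y =>
    ρ.locallyFinite.point_finite y
  have hsupp : ∀ (y : KTangentBundle E Q k) (a : Fin k),
      (Function.support fun i => ρ i y • V i y a) ⊆ (hfin y).toFinset := fun y a i hi => by
    rw [Finite.coe_toFinset]
    exact left_ne_zero_of_smul hi
  -- One finite index set serves all `k` slots, so linearity of `Ω` on tuples can be applied.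
  have hsum : ∀ y : KTangentBundle E Q k, (fun a => ∑ᶠ i, ρ i y • V i y a) =
      ∑ i ∈ (hfin y).toFinset, ρ i y • V i y := fun y => by
    funext a
    rw [finsum_eq_sum_of_support_subset _ (hsupp y a), Finset.sum_apply]
    rfl
  refine ⟨fun y a => ∑ᶠ i, ρ i y • V i y a, ⟨fun a => ?_, fun y => ?_⟩, fun y hy => ?_⟩
  · refine ContMDiff.finsum_section_of_locallyFinite
      (V := (TangentSpace (kModel E k) : KTangentBundle E Q k → Type _))
      (t := fun i y => ρ i y • V i y a) ?_ fun i => ?_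
    · exact ρ.locallyFinite.subset fun i y hy => left_ne_zero_of_smul hy
    · exact ContMDiff.smul_section (ρ i).contMDiff ((hV i i.2).1 a)
  · have h : IsVerticalAt y (fun a => ∑ᶠ i, ρ i y • V i y a) ↔
        (∑ i ∈ (hfin y).toFinset, ρ i y • V i y) ∈ verticalSubmodule y := by
      rw [hsum y]
      rfl
    exact h.2 (Submodule.sum_mem _ fun i _ => Submodule.smul_mem _ _ ((hV i i.2).2 y))
  · refine (congrArg (Omega L y) (hsum y)).trans ?_
    have h₁ : ∑ i ∈ (hfin y).toFinset, ρ i y = 1 := by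
      rw [← ρ.sum_eq_one hy, finsum_eq_sum_of_support_subset]
      rw [Finite.coe_toFinset]
    rw [← omegaLin_apply, map_sum]
    -- A nonzero weight at `y` forces `y` into the set where the local solution is valid; since the
    -- weights sum to `1` on `C`, the affine equation survives the averaging.
    have h₂ : ∀ i ∈ (hfin y).toFinset, omegaLin L y (ρ i y • V i y) =
        ρ i y • - Omega L y (Y y) := fun i hi => by
      have hi' : y ∈ O i := hρ i (subset_closure ((hfin y).mem_toFinset.1 hi))
      rw [map_smul, omegaLin_apply, hVO i i.2 y ⟨hi', hy⟩]
    rw [Finset.sum_congr rfl h₂, ← Finset.sum_smul, h₁, one_smul]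

/-- Constant dimension identifies `S1` with the closed set defined by fields in `𝔐`. Local vertical
corrections then glue to a global `V`, and `X + Y + V` is the required SOPDE. -/
theorem isGreatest_S1_of_isClosed [SecondCountableTopology Q]
    (hL : ContMDiff (kModel E k) 𝓘(ℝ, ℝ) ∞ L) (hX : SmoothKVF X) (hY : SmoothKVF Y)
    (hXL : ∀ x ∈ P1 L, LagrangianEqAt L x (X x)) (hXY : IsSopde (X + Y))
    (hrank : ∀ x ∈ P1 L, ∀ᶠ y in 𝓝 x,
      Module.finrank ℝ (frakMAt L y) = Module.finrank ℝ (frakMAt L x))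
    (hP : IsClosed (P1 L)) :
    IsGreatest {S | S ⊆ P1 L ∧ ∃ Γ : KVF E Q k, SmoothKVF Γ ∧ IsSopde Γ ∧
      ∀ x ∈ S, LagrangianEqAt L x (Γ x)} (S1 L X) := by
  refine ⟨⟨fun x hx => hx.1, ?_⟩, ?_⟩
  · rw [S1_eq_constraintSet hXY]
    have hC : IsClosed (constraintSet L Y) := by
      rw [constraintSet_eq_fieldConstraintSet hL hrank]
      exact isClosed_fieldConstraintSet hL hY hP
    obtain ⟨V, hV, hVC⟩ := exists_global_vertical_solution (L := L) (Y := Y) hC fun x hx => by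
      obtain ⟨V, hV, O, hO, hxO, h⟩ := exists_local_vertical_solution hL hY (hrank x hx.1)
      exact ⟨V, hV, O, hO, hxO, fun y hy => h y hy.1 hy.2.2⟩
    exact ⟨X + Y + V, smoothKVF_add (smoothKVF_add hX hY) hV.1,
      isSopde_add_vertical hXY hV.2, fun x hx => lagrangianEqAt_add (hXL x hx.1) (hVC x hx)⟩
  · rintro S ⟨hSP, Γ, -, hΓ, hΓL⟩ x hx
    exact mem_S1_of_sopde hXL hΓ (hSP hx) (hΓL x hx)

end GlobalSolution

end KSymplectic

end

/-! ### The theorem on the constraint set `S1` -/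

theorem mainTheorem1
    {E : Type*} [NormedAddCommGroup E] [NormedSpace ℝ E] [FiniteDimensional ℝ E]
    {Q : Type*} [TopologicalSpace Q] [T2Space Q] [SecondCountableTopology Q]
    [ChartedSpace E Q] [IsManifold 𝓘(ℝ, E) ∞ Q] (k : ℕ)
    (L : KSymplectic.KTangentBundle E Q k → ℝ)
    (hL : ContMDiff (KSymplectic.kModel E k) 𝓘(ℝ, ℝ) ∞ L)
    (X Y : KSymplectic.KVF E Q k)
    (hX : KSymplectic.SmoothKVF X) (hY : KSymplectic.SmoothKVF Y)
    (hXL : ∀ x ∈ KSymplectic.P1 L, KSymplectic.LagrangianEqAt L x (X x))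
    (hXY : KSymplectic.IsSopde (X + Y)) :
    -- `S₁` is the maximal subset of `P₁` on which SOPDE solutions exist
    IsGreatest {S | S ⊆ KSymplectic.P1 L ∧ ∀ x ∈ S, ∃ Γ : KSymplectic.KVF E Q k,
        KSymplectic.SmoothKVF Γ ∧ KSymplectic.IsSopde Γ ∧ KSymplectic.LagrangianEqAt L x (Γ x)}
      (KSymplectic.S1 L X) ∧
    -- its description through the annihilator of the vertical `k`-vectors
    KSymplectic.S1 L X = KSymplectic.constraintSet L Y ∧
    -- its description through the vector fields in `𝔐`
    KSymplectic.S1 L X ⊆ KSymplectic.fieldConstraintSet L Y ∧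
    ((∀ x ∈ KSymplectic.P1 L, ∀ᶠ y in 𝓝 x,
        Module.finrank ℝ (KSymplectic.frakMAt L y) = Module.finrank ℝ (KSymplectic.frakMAt L x)) →
      KSymplectic.S1 L X = KSymplectic.fieldConstraintSet L Y ∧
      (IsClosed (KSymplectic.P1 L) →
        IsGreatest {S | S ⊆ KSymplectic.P1 L ∧ ∃ Γ : KSymplectic.KVF E Q k,
            KSymplectic.SmoothKVF Γ ∧ KSymplectic.IsSopde Γ ∧
            ∀ x ∈ S, KSymplectic.LagrangianEqAt L x (Γ x)}
          (KSymplectic.S1 L X))) ∧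
    -- independence of the choices
    (∀ X' Y' : KSymplectic.KVF E Q k, KSymplectic.SmoothKVF X' → KSymplectic.SmoothKVF Y' →
      (∀ x ∈ KSymplectic.P1 L, KSymplectic.LagrangianEqAt L x (X' x)) →
      KSymplectic.IsSopde (X' + Y') →
      KSymplectic.S1 L X' = KSymplectic.S1 L X ∧
      KSymplectic.constraintSet L Y' = KSymplectic.constraintSet L Y ∧
      KSymplectic.fieldConstraintSet L Y' = KSymplectic.fieldConstraintSet L Y) := by
  have hgr := KSymplectic.isGreatest_S1 (L := L) hX hY hXL hXY
  have hc := KSymplectic.S1_eq_constraintSet (L := L) hXY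
  refine ⟨hgr, hc, hc ▸ KSymplectic.constraintSet_subset_fieldConstraintSet, fun hrank => ⟨?_,
    KSymplectic.isGreatest_S1_of_isClosed hL hX hY hXL hXY hrank⟩, ?_⟩
  · rw [hc, KSymplectic.constraintSet_eq_fieldConstraintSet hL hrank]
  · intro X' Y' hX' hY' hXL' hXY'
    -- The family of which `S1` is the greatest element involves neither `X` nor `Y`, so uniqueness
    -- of greatest elements gives independence.
    have hS := (KSymplectic.isGreatest_S1 (L := L) hX' hY' hXL' hXY').unique hgr
    refine ⟨hS, ?_, KSymplectic.fieldConstraintSet_eq hX hY hXL hXY hX' hY' hXL' hXY'⟩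
    rw [← KSymplectic.S1_eq_constraintSet hXY', hS, hc]
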